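/- Fix real numbers $0<\delta\le m$ and let $\mathscr W=\bigcup_{\delta\le s\le m}L^2[0,s)$, where $L^2[0,s)$ consists of real-valued functions and $\ell(f)=s$ denotes the length of the domain of $f\in L^2[0,s)$. Equip $\mathscr W$ with the topology in which $f_n\to f$ if and only if $\ell(f_n)\to\ell(f)$ and the extensions of $f_n$ by zero converge in $L^2(\mathbb R)$ to that of $f$ (that is, the topology induced by $f\mapsto(\ell(f),f\mathbf 1_{[0,\ell(f))})\in\mathbb R\times L^2(\mathbb R)$), and with its Borel $\sigma$-algebra. For $E\in\mathbb R$ and $w\in\mathscr W$ let $A^E(w)\in \mathrm{SL}(2,\mathbb R)$ be the transfer matrix, i.e. the unique matrix such that $$\begin{pmatrix}\psi(\ell(w))\\ \psi'(\ell(w))\end{pmatrix}=A^E(w)\begin{pmatrix}\psi(0)\\ \psi'(0)\end{pmatrix}$$ for every solution $\psi$ of $-\psi''+w\psi=E\psi$ on $[0,\ell(w)]$ ($\psi'$ absolutely continuous, equation almost everywhere). For $f_1\in L^2[0,a_1)$ and $f_2\in L^2[0,a_2)$ let $f_1\star f_2\in L^2[0,a_1+a_2)$ be the concatenation, equal to $f_1(x)$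 for $0\le x<a_1$ and to $f_2(x-a_1)$ for $a_1\le x<a_1+a_2$. Let $\widetilde\mu$ be a Borel probability measure on $\mathscr W$ satisfying (NC) there exist $f_1,f_2\in\operatorname{supp}\widetilde\mu$ such that $f_1\star f_2\ne f_2\star f_1$ in $L^2$, that is, they differ on a set of positive Lebesgue measure. For $E\in\mathbb R$ let $\nu_E=A^E_*\widetilde\mu$ be the pushforward of $\widetilde\mu$ under $A^E$ and let $G_{\nu_E}$ be the smallest closed subgroup of $\mathrm{SL}(2,\mathbb R)$ containing $\operatorname{supp}\nu_E$. **Theorem.** There is a discrete set $D\subset\mathbb R$ (closed, i.e. without finite accumulation points) such that for every $E\in\mathbb R\setminus D$ the group $G=G_{\nu_E}$ is a type-F subgroup of $\mathrm{SL}(2,\mathbb R)$, that is: 1. $G$ is contracting: there are $g_1,g_2,\ldots\in G$ such that $\|g_n\|^{-1}g_n$ converges to a rank-one operator as $n\to\infty$; 2. there is no set $\Lambda\subseteq\mathbb{RP}^1$ of cardinality one or two with $g\Lambda=\Lambda$ for all $g\in G$. -/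

import Mathlib

open MeasureTheory Filter Topology
open scoped MatrixGroups LinearAlgebra.Projectivization Pointwise

namespace ContinuumAnderson

noncomputable section

/-- The space `𝒲 = ⋃_{δ ≤ s ≤ m} L²[0,s)` of real-valued local potentials: a point is a length
`s = ℓ(f) ∈ [δ, m]` together with an element `f` of `L²[0,s)`. -/
structure Piece (δ m : ℝ) where
  /-- the length `ℓ(f)` of the domain -/
  len : ℝ
  len_mem : len ∈ Set.Icc δ m
  /-- the element of `L²[0,ℓ(f))` -/
  pot : Lp ℝ 2 (volume.restrict (Set.Ico 0 len))

/-- Extension by zero, `L²[0,s) ↪ L²(ℝ)`. -/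
def Piece.ext {δ m : ℝ} (w : Piece δ m) : Lp ℝ 2 (volume : Measure ℝ) :=
  ((memLp_indicator_iff_restrict measurableSet_Ico).2 (Lp.memLp w.pot)).toLp
    ((Set.Ico 0 w.len).indicator w.pot)

theorem Piece.coeFn_ext {δ m : ℝ} (w : Piece δ m) :
    w.ext =ᵐ[volume] (Set.Ico 0 w.len).indicator w.pot := by
  unfold Piece.ext
  exact MemLp.coeFn_toLp _

/-- The topology of `𝒲`: two potentials are close when their lengths are close and their
extensions by zero are close in `L²(ℝ)`. -/
instance {δ m : ℝ} : TopologicalSpace (Piece δ m) :=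
  TopologicalSpace.induced (fun w => (w.len, w.ext)) inferInstance

instance {δ m : ℝ} : MeasurableSpace (Piece δ m) := borel _

instance {δ m : ℝ} : BorelSpace (Piece δ m) := ⟨rfl⟩

instance : MeasurableSpace SL(2, ℝ) := borel _

instance : BorelSpace SL(2, ℝ) := ⟨rfl⟩

/-- The concatenation of `f₁` on `[0,a₁)` and `f₂`, as a function on `[0,a₁+a₂)`. -/
def concat (a₁ : ℝ) (f₁ f₂ : ℝ → ℝ) : ℝ → ℝ :=
  fun x => if x < a₁ then f₁ x else f₂ (x - a₁)

/-- The nontriviality condition (NC): there are `f₁, f₂ ∈ supp μ` whose two concatenations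
`f₁ ⋆ f₂` and `f₂ ⋆ f₁` differ as elements of `L²[0, a₁ + a₂)`. -/
def Nontriviality {δ m : ℝ} (μ : Measure (Piece δ m)) : Prop :=
  ∃ f₁ ∈ μ.support, ∃ f₂ ∈ μ.support,
    ¬ (concat f₁.len f₁.pot f₂.pot
        =ᵐ[volume.restrict (Set.Ico 0 (f₁.len + f₂.len))] concat f₂.len f₂.pot f₁.pot)

/-- `ψ` solves `-ψ'' + wψ = Eψ` on `[0, ℓ(w)]` and has derivative `ψ'` there. As usual for `L²`
potentials, this means that `ψ` is differentiable, and that its derivative is absolutely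
continuous with `ψ'' = (w - E) ψ` almost everywhere, i.e. `ψ'` is the indefinite integral
of `(w - E) ψ`. -/
structure IsSolution {δ m : ℝ} (E : ℝ) (w : Piece δ m) (ψ ψ' : ℝ → ℝ) : Prop where
  hasDeriv : ∀ x ∈ Set.Icc 0 w.len, HasDerivWithinAt ψ (ψ' x) (Set.Icc 0 w.len) x
  deriv_eq : ∀ x ∈ Set.Icc 0 w.len, ψ' x = ψ' 0 + ∫ t in (0 : ℝ)..x, (w.pot t - E) * ψ t

/-- `M` maps the Cauchy data at `0` of each solution to its Cauchy data at `ℓ(w)`. -/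
def IsTransferMatrix {δ m : ℝ} (E : ℝ) (w : Piece δ m) (M : SL(2, ℝ)) : Prop :=
  ∀ ψ ψ' : ℝ → ℝ, IsSolution E w ψ ψ' →
    ![ψ w.len, ψ' w.len] = (M : Matrix (Fin 2) (Fin 2) ℝ).mulVec ![ψ 0, ψ' 0]

/-- The transfer matrix `A^E(w)`, the one element of `SL(2,ℝ)` with `IsTransferMatrix E w`
(there is always exactly one such element when `0 < δ`). -/
def transferMatrix {δ m : ℝ} (E : ℝ) (w : Piece δ m) : SL(2, ℝ) :=
  Classical.epsilon (IsTransferMatrix E w)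

/-- `G_{ν_E}`: the smallest closed subgroup of `SL(2,ℝ)` that contains the support of the
pushforward `ν_E` of `μ` under `A^E`. -/
def transferGroup {δ m : ℝ} (μ : Measure (Piece δ m)) (E : ℝ) : Subgroup SL(2, ℝ) :=
  (Subgroup.closure (μ.map (transferMatrix E)).support).topologicalClosure

/-- `G` is contracting: for some `g₁, g₂, … ∈ G` the matrices `‖gₙ‖⁻¹ gₙ` (operator norm) converge
to a matrix of rank one. -/
def IsContracting (G : Subgroup SL(2, ℝ)) : Prop :=
  ∃ g : ℕ → SL(2, ℝ), (∀ n, g n ∈ G) ∧ ∃ L : Matrix (Fin 2) (Fin 2) ℝ, L.rank = 1 ∧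
    Tendsto (fun n => ‖Matrix.toEuclideanCLM (𝕜 := ℝ) (g n : Matrix (Fin 2) (Fin 2) ℝ)‖⁻¹ •
      (g n : Matrix (Fin 2) (Fin 2) ℝ)) atTop (𝓝 L)

/-- `G` is of type F: it is contracting, and no `Λ ⊆ ℝP¹` of cardinality one or two satisfies
`gΛ = Λ` for all `g ∈ G`. -/
structure IsTypeF (G : Subgroup SL(2, ℝ)) : Prop where
  contracting : IsContracting G
  no_invariant : ¬ ∃ Λ : Set (ℙ ℝ (Fin 2 → ℝ)),
    (Λ.ncard = 1 ∨ Λ.ncard = 2) ∧ ∀ g ∈ G, g • Λ = Λ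

end

end ContinuumAnderson

/-! Let `f₁`, `f₂` in the support have distinct concatenations, and let M₁, M₂ be their transfer
matrices. As the transfer matrix depends continuously on the piece, M₁ and M₂ lie in G. By
`isTypeF_of_mem`, G is of type F as soon as tr M₁ ≠ 0, (tr M₁)² ≠ 4, tr M₂ ≠ 0 and det(M₁M₂ - M₂M₁)
≠ 0. If M₁ is hyperbolic, its powers are unbounded. If it is elliptic, the group commutator of M₁
and M₂ has trace 2 - det(M₁M₂ - M₂M₁) > 2 and is hyperbolic. An element of nonzero trace fixes every
point of an invariant set of at most two lines, so such a set would give M₁ and M₂ a common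
eigenvector, and det(M₁M₂ - M₂M₁) would vanish.

The entries of M₁ and M₂ are entire in E, since solutions come from inverting a Volterra-type
operator that is affine in E. The four conditions therefore fail only on the real zeros of one
entire function, a closed discrete set unless some factor vanishes identically. For the traces, tr
M(k²) = 2 cos(kL) + O(1/k) excludes this.

For the determinant, suppose that it vanishes for all E. At elliptic real energies of M₁ a singular
commutator is zero, so M₁ and M₂ commute on an interval and, by the identity theorem, for all
complex E. Then `f₁ ⋆ f₂` and `f₂ ⋆ f₁` have the same transfer matrix at every energy. The Borg-type
theorem `ae_eq_of_forall_solution_eq` makes them equal, against (NC). That theorem compares the two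
flows at each x: the first row of the matrix relating them is entire in E and tends to (1, 0) as |E|
→ ∞, so it is constant by Liouville. -/

namespace ContinuumAnderson

open Set intervalIntegral
open scoped BoundedContinuousFunction

/-! ### Calculus of indefinite integrals on an interval -/

/-- `F` is absolutely continuous on `[0, L]` with almost everywhere derivative `f`: it is an
indefinite integral of the integrable function `f`. -/
structure HasIntegralDeriv (L : ℝ) (F f : ℝ → ℂ) : Prop where
  integrable : IntervalIntegrable f volume 0 L
  eq_add : ∀ x ∈ Icc 0 L, F x = F 0 + ∫ t in (0 : ℝ)..x, f t

namespace HasIntegralDeriv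

variable {L : ℝ} {F G f g : ℝ → ℂ}

theorem integrable_of_mem (h : HasIntegralDeriv L F f) {x y : ℝ} (hx : x ∈ Icc 0 L)
    (hy : y ∈ Icc 0 L) : IntervalIntegrable f volume x y := by
  have hL : (0 : ℝ) ≤ L := hx.1.trans hx.2
  refine h.integrable.mono_set (uIcc_subset_uIcc ?_ ?_) <;> rwa [uIcc_of_le hL]

theorem sub_eq (h : HasIntegralDeriv L F f) {x y : ℝ} (hx : x ∈ Icc 0 L) (hy : y ∈ Icc 0 L) :
    F y - F x = ∫ t in x..y, f t := by
  have h0 : (0 : ℝ) ∈ Icc 0 L := ⟨le_rfl, hx.1.trans hx.2⟩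
  rw [h.eq_add x hx, h.eq_add y hy,
    ← integral_interval_sub_left (h.integrable_of_mem h0 hy) (h.integrable_of_mem h0 hx)]
  ring

/-- Increments of F are dominated by those of the primitive of ‖f‖, so F inherits absolute
continuity from that primitive. -/
theorem absolutelyContinuousOnInterval (hL : 0 ≤ L) (h : HasIntegralDeriv L F f) :
    AbsolutelyContinuousOnInterval F 0 L := by
  have key := h.integrable.norm.absolutelyContinuousOnInterval_intervalIntegral
    (c := 0) (by simp)
  unfold AbsolutelyContinuousOnInterval at key ⊢
  refine squeeze_zero' (Eventually.of_forall fun E => Finset.sum_nonneg fun _ _ => dist_nonneg)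
    ?_ key
  have hE : ∀ᶠ E in AbsolutelyContinuousOnInterval.totalLengthFilter ⊓
      𝓟 (AbsolutelyContinuousOnInterval.disjWithin 0 L),
      E ∈ AbsolutelyContinuousOnInterval.disjWithin 0 L :=
    mem_inf_of_right (mem_principal_self _)
  filter_upwards [hE] with E hE
  refine Finset.sum_le_sum fun i hi => ?_
  have hm := hE.1 i hi
  rw [uIcc_of_le hL] at hm
  have h0 : (0 : ℝ) ∈ Icc 0 L := ⟨le_rfl, hL⟩
  rw [dist_comm, dist_eq_norm, h.sub_eq hm.1 hm.2, dist_comm, Real.dist_eq,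
    integral_interval_sub_left (h.integrable_of_mem h0 hm.2).norm
      (h.integrable_of_mem h0 hm.1).norm]
  exact norm_integral_le_abs_integral_norm

theorem continuousOn (h : HasIntegralDeriv L F f) : ContinuousOn F (Icc 0 L) := by
  rcases le_or_gt 0 L with hL | hL
  · simpa [uIcc_of_le hL] using (h.absolutelyContinuousOnInterval hL).continuousOn
  · simp [Icc_eq_empty_of_lt hL]

theorem ae_hasDerivAt (hL : 0 ≤ L) (h : HasIntegralDeriv L F f) :
    ∀ᵐ x, x ∈ Icc 0 L → HasDerivAt F (f x) x := by
  have h₁ : ∀ᵐ x : ℝ, x ≠ 0 := by simp [ae_iff, measure_singleton]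
  have h₂ : ∀ᵐ x : ℝ, x ≠ L := by simp [ae_iff, measure_singleton]
  filter_upwards [h.integrable.ae_hasDerivAt_integral, h₁, h₂] with x hx hx1 hx2 hxL
  have hd := (hx (by rwa [uIcc_of_le hL]) 0 (by simp)).const_add (F 0)
  refine hd.congr_of_eventuallyEq ?_
  filter_upwards [Icc_mem_nhds (lt_of_le_of_ne hxL.1 hx1.symm) (lt_of_le_of_ne hxL.2 hx2)]
    with y hy using h.eq_add y hy

/-- The fundamental theorem of calculus for absolutely continuous functions. -/
theorem of_absolutelyContinuous (hL : 0 ≤ L) (hF : AbsolutelyContinuousOnInterval F 0 L)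
    (hf : IntervalIntegrable f volume 0 L) (hd : ∀ᵐ x, x ∈ Icc 0 L → HasDerivAt F (f x) x) :
    HasIntegralDeriv L F f := by
  refine ⟨hf, ?_⟩
  have hG : HasIntegralDeriv L (fun x => ∫ t in (0 : ℝ)..x, f t) f := ⟨hf, by simp⟩
  -- F minus the primitive of f is absolutely continuous with derivative zero almost everywhere,
  -- hence constant.
  obtain ⟨C, hC⟩ := (hF.sub (hG.absolutelyContinuousOnInterval hL)).const_of_ae_hasDerivAt_zero
    (by
      filter_upwards [hd, hG.ae_hasDerivAt hL] with x h1 h2 hx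
      rw [uIcc_of_le hL] at hx
      simpa using (h1 hx).sub (h2 hx))
  rw [uIcc_of_le hL] at hC
  intro x hx
  have h1 := hC x hx
  have h2 := hC 0 ⟨le_rfl, hL⟩
  simp only [Pi.sub_apply, integral_same, sub_zero] at h1 h2
  rw [h2, ← h1]
  ring

theorem of_hasDerivAt (hF : ∀ x, HasDerivAt F (f x) x) (hf : Continuous f) :
    HasIntegralDeriv L F f :=
  ⟨hf.intervalIntegrable _ _, fun x _ => by
    rw [integral_eq_sub_of_hasDerivAt (fun y _ => hF y) (hf.intervalIntegrable _ _)]; ring⟩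

/-- The product rule. -/
theorem mul (hL : 0 ≤ L) (hF : HasIntegralDeriv L F f) (hG : HasIntegralDeriv L G g) :
    HasIntegralDeriv L (fun x => F x * G x) (fun x => f x * G x + F x * g x) := by
  refine of_absolutelyContinuous hL
    ((hF.absolutelyContinuousOnInterval hL).smul (hG.absolutelyContinuousOnInterval hL)) ?_ ?_
  · have h1 := hF.continuousOn
    have h2 := hG.continuousOn
    rw [← uIcc_of_le hL] at h1 h2
    exact (hF.integrable.mul_continuousOn h2).add (hG.integrable.continuousOn_mul h1)
  · filter_upwards [hF.ae_hasDerivAt hL, hG.ae_hasDerivAt hL] with x h1 h2 hx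
    exact (h1 hx).mul (h2 hx)

theorem mono_mem (hF : HasIntegralDeriv L F f) {x : ℝ} (hx : x ∈ Icc 0 L) :
    HasIntegralDeriv x F f :=
  ⟨hF.integrable_of_mem ⟨le_rfl, hx.1.trans hx.2⟩ hx,
    fun y hy => hF.eq_add y ⟨hy.1, hy.2.trans hx.2⟩⟩

theorem add (hF : HasIntegralDeriv L F f) (hG : HasIntegralDeriv L G g) :
    HasIntegralDeriv L (fun x => F x + G x) (fun x => f x + g x) := by
  refine ⟨hF.integrable.add hG.integrable, fun x hx => ?_⟩
  rw [integral_add (hF.mono_mem hx).integrable (hG.mono_mem hx).integrable, hF.eq_add x hx,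
    hG.eq_add x hx]
  ring

theorem const_mul (hF : HasIntegralDeriv L F f) (a : ℂ) :
    HasIntegralDeriv L (fun x => a * F x) (fun x => a * f x) := by
  refine ⟨hF.integrable.const_mul a, fun x hx => ?_⟩
  rw [intervalIntegral.integral_const_mul, hF.eq_add x hx]
  ring

theorem sub (hF : HasIntegralDeriv L F f) (hG : HasIntegralDeriv L G g) :
    HasIntegralDeriv L (fun x => F x - G x) (fun x => f x - g x) := by
  simpa [sub_eq_add_neg] using hF.add (hG.const_mul (-1))

theorem congr_deriv (hL : 0 ≤ L) (hF : HasIntegralDeriv L F f)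
    (h : ∀ᵐ x, x ∈ Ioc 0 L → f x = g x) : HasIntegralDeriv L F g := by
  refine ⟨hF.integrable.congr_ae ?_, fun x hx => ?_⟩
  · rw [uIoc_of_le hL]
    exact (ae_restrict_iff' measurableSet_Ioc).2 h
  · rw [hF.eq_add x hx]
    congr 1
    refine integral_congr_ae ?_
    filter_upwards [h] with t ht htx
    rw [uIoc_of_le hx.1] at htx
    exact ht ⟨htx.1, htx.2.trans hx.2⟩

theorem congr_fun (hF : HasIntegralDeriv L F f) (h : ∀ x ∈ Icc 0 L, F x = G x) :
    HasIntegralDeriv L G f :=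
  ⟨hF.integrable, fun x hx => by
    rw [← h x hx, hF.eq_add x hx, h 0 ⟨le_rfl, hx.1.trans hx.2⟩]⟩

theorem const_of_zero (hF : HasIntegralDeriv L F f) (h : ∀ x ∈ Icc 0 L, f x = 0) {x : ℝ}
    (hx : x ∈ Icc 0 L) : F x = F 0 := by
  rw [hF.eq_add x hx, integral_congr (g := fun _ => 0), intervalIntegral.integral_zero, add_zero]
  intro t ht
  rw [uIcc_of_le hx.1] at ht
  exact h t ⟨ht.1, ht.2.trans hx.2⟩

theorem shift {a : ℝ} (ha : 0 ≤ a) (haL : a ≤ L) (hF : HasIntegralDeriv L F f) :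
    HasIntegralDeriv (L - a) (fun x => F (x + a)) (fun x => f (x + a)) := by
  have hL : L ∈ Icc 0 L := ⟨ha.trans haL, le_rfl⟩
  refine ⟨?_, fun x hx => ?_⟩
  · simpa using (hF.integrable_of_mem ⟨ha, haL⟩ hL).comp_add_right a
  · rw [integral_comp_add_right, zero_add,
      ← hF.sub_eq ⟨ha, haL⟩ ⟨by linarith [hx.1], by linarith [hx.2]⟩]
    ring

theorem reflect (hF : HasIntegralDeriv L F f) :
    HasIntegralDeriv L (fun x => F (L - x)) (fun x => -f (L - x)) := by
  refine ⟨?_, fun x hx => ?_⟩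
  · have h := (hF.integrable.comp_sub_left L).symm.neg
    simp only [sub_zero, sub_self] at h
    exact h
  · have hL : L ∈ Icc 0 L := ⟨hx.1.trans hx.2, le_rfl⟩
    rw [intervalIntegral.integral_neg, integral_comp_sub_left, sub_zero,
      ← hF.sub_eq ⟨by linarith [hx.2], by linarith [hx.1]⟩ hL]
    ring

end HasIntegralDeriv

/-! ### Schrödinger solutions and Wronskians -/

/-- `u` solves `-u'' + q u = E u` on `[0, L]`, with derivative `u'`. -/
structure IsSchrodinger (L : ℝ) (q : ℝ → ℂ) (E : ℂ) (u u' : ℝ → ℂ) : Prop where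
  deriv : HasIntegralDeriv L u u'
  deriv_deriv : HasIntegralDeriv L u' (fun x => (q x - E) * u x)

namespace IsSchrodinger

variable {L : ℝ} {q : ℝ → ℂ} {E : ℂ} {u u' v v' : ℝ → ℂ}

/-- The derivative of the Wronskian is u(q - E)v - (q - E)uv, which cancels because both functions
solve the same equation. -/
theorem wronskian_eq (hL : 0 ≤ L) (hu : IsSchrodinger L q E u u')
    (hv : IsSchrodinger L q E v v') {x : ℝ} (hx : x ∈ Icc 0 L) :
    u x * v' x - u' x * v x = u 0 * v' 0 - u' 0 * v 0 :=
  ((hu.deriv.mul hL hv.deriv_deriv).sub (hu.deriv_deriv.mul hL hv.deriv)).const_of_zero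
    (fun x _ => by ring) hx

theorem linearCombination (hu : IsSchrodinger L q E u u') (hv : IsSchrodinger L q E v v')
    (a b : ℂ) : IsSchrodinger L q E (fun x => a * u x + b * v x)
      (fun x => a * u' x + b * v' x) := by
  refine ⟨(hu.deriv.const_mul a).add (hv.deriv.const_mul b), ?_⟩
  convert (hu.deriv_deriv.const_mul a).add (hv.deriv_deriv.const_mul b) using 2
  ring

theorem mono_mem (hu : IsSchrodinger L q E u u') {x : ℝ} (hx : x ∈ Icc 0 L) :
    IsSchrodinger x q E u u' :=
  ⟨hu.deriv.mono_mem hx, hu.deriv_deriv.mono_mem hx⟩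

theorem congr_potential {p : ℝ → ℂ} (hL : 0 ≤ L) (hu : IsSchrodinger L q E u u')
    (h : ∀ᵐ x, x ∈ Ioc 0 L → q x = p x) : IsSchrodinger L p E u u' :=
  ⟨hu.deriv, hu.deriv_deriv.congr_deriv hL <| by
    filter_upwards [h] with x hx hxL using by rw [hx hxL]⟩

theorem shift {a : ℝ} (ha : 0 ≤ a) (haL : a ≤ L) (hu : IsSchrodinger L q E u u') :
    IsSchrodinger (L - a) (fun x => q (x + a)) E (fun x => u (x + a)) (fun x => u' (x + a)) :=
  ⟨hu.deriv.shift ha haL, hu.deriv_deriv.shift ha haL⟩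

/-- Exchanges the two end points, so that estimates for data at 0 also serve for data at L. -/
theorem reflect (hu : IsSchrodinger L q E u u') :
    IsSchrodinger L (fun x => q (L - x)) E (fun x => u (L - x)) (fun x => -u' (L - x)) := by
  refine ⟨hu.deriv.reflect, ?_⟩
  simpa using hu.deriv_deriv.reflect.const_mul (-1)

end IsSchrodinger

/-- The pair of solutions with Cauchy data `(1, 0)` and `(0, 1)` at `0`. -/
structure IsFundamental (L : ℝ) (q : ℝ → ℂ) (E : ℂ) (c c' s s' : ℝ → ℂ) : Prop where
  cos : IsSchrodinger L q E c c'
  sin : IsSchrodinger L q E s s'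
  cos_zero : c 0 = 1
  cos_deriv_zero : c' 0 = 0
  sin_zero : s 0 = 0
  sin_deriv_zero : s' 0 = 1

namespace IsFundamental

variable {L : ℝ} {q : ℝ → ℂ} {E : ℂ} {u u' c c' s s' : ℝ → ℂ}

theorem det_eq_one (hL : 0 ≤ L) (h : IsFundamental L q E c c' s s') {x : ℝ}
    (hx : x ∈ Icc 0 L) : c x * s' x - c' x * s x = 1 := by
  rw [h.cos.wronskian_eq hL h.sin hx, h.cos_zero, h.cos_deriv_zero, h.sin_deriv_zero]
  ring

/-- Cramer's rule: the constant Wronskians of u with s and c are u(0) and u'(0), and c, s have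
Wronskian 1. This also gives uniqueness of solutions. -/
theorem eq_combination (hL : 0 ≤ L) (h : IsFundamental L q E c c' s s')
    (hu : IsSchrodinger L q E u u') {x : ℝ} (hx : x ∈ Icc 0 L) :
    u x = u 0 * c x + u' 0 * s x := by
  have h1 := h.det_eq_one hL hx
  have h2 := hu.wronskian_eq hL h.sin hx
  have h3 := h.cos.wronskian_eq hL hu hx
  simp only [h.cos_zero, h.cos_deriv_zero, h.sin_deriv_zero, h.sin_zero] at h2 h3
  linear_combination (-u x) * h1 + c x * h2 + s x * h3

theorem deriv_eq_combination (hL : 0 ≤ L) (h : IsFundamental L q E c c' s s')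
    (hu : IsSchrodinger L q E u u') {x : ℝ} (hx : x ∈ Icc 0 L) :
    u' x = u 0 * c' x + u' 0 * s' x := by
  have h1 := h.det_eq_one hL hx
  have h2 := hu.wronskian_eq hL h.sin hx
  have h3 := h.cos.wronskian_eq hL hu hx
  simp only [h.cos_zero, h.cos_deriv_zero, h.sin_deriv_zero, h.sin_zero] at h2 h3
  linear_combination (-u' x) * h1 + c' x * h2 + s' x * h3

end IsFundamental

/-! ### Operators depending on a parameter -/

theorem tendsto_clm_apply {X ι : Type*} [NormedAddCommGroup X] [NormedSpace ℂ X]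
    {l : Filter ι} {T : ι → X →L[ℂ] X} {T₀ : X →L[ℂ] X}
    {v : ι → X} {v₀ : X} (hT : Tendsto T l (𝓝 T₀)) (hv : Tendsto v l (𝓝 v₀)) :
    Tendsto (fun i => T i (v i)) l (𝓝 (T₀ v₀)) :=
  (isBoundedBilinearMap_apply (𝕜 := ℂ)).continuous.continuousAt.tendsto.comp (hT.prodMk_nhds hv)

theorem differentiable_clm_comp {X Y : Type*} [NormedAddCommGroup X] [NormedSpace ℂ X]
    [NormedAddCommGroup Y] [NormedSpace ℂ Y] (φ : X →L[ℂ] Y) {f : ℂ → X}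
    (hf : Differentiable ℂ f) : Differentiable ℂ fun E => φ (f E) :=
  φ.differentiable.comp hf

theorem differentiable_add_smul {X : Type*} [NormedAddCommGroup X] [NormedSpace ℂ X] (v w : X) :
    Differentiable ℂ fun E : ℂ => v + E • w :=
  (differentiable_const v).add (differentiable_id.smul_const w)

section Inverse

variable {X : Type*} [NormedAddCommGroup X] [NormedSpace ℂ X] [CompleteSpace X]

theorem isUnit_one_sub_clm {A : X →L[ℂ] X} (hA : ‖A‖ < 1) : IsUnit (1 - A) :=
  isUnit_one_sub_of_norm_lt_one hA

theorem differentiable_inverse_clm {T : ℂ → X →L[ℂ] X} (hT : Differentiable ℂ T)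
    (hu : ∀ E, IsUnit (T E)) : Differentiable ℂ fun E => Ring.inverse (T E) :=
  fun E => (differentiableAt_inverse (𝕜 := ℂ) (hu E)).comp E (hT E)

theorem tendsto_inverse_clm {ι : Type*} {l : Filter ι} {T : ι → X →L[ℂ] X} {T₀ : X →L[ℂ] X}
    (hT : Tendsto T l (𝓝 T₀)) (hu : IsUnit T₀) :
    Tendsto (fun i => Ring.inverse (T i)) l (𝓝 (Ring.inverse T₀)) := by
  obtain ⟨u, rfl⟩ := hu
  exact (NormedRing.inverse_continuousAt u).tendsto.comp hT

end Inverse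

/-! ### Solving the equation by Volterra operators -/

section Volterra

variable {L : ℝ} (hL : 0 ≤ L) {g g₁ g₂ q : ℝ → ℂ}

theorem continuous_IccExtend_coe (f : (Icc 0 L →ᵇ ℂ)) : Continuous (IccExtend hL f) :=
  f.continuous.Icc_extend'

theorem norm_IccExtend_le (f : (Icc 0 L →ᵇ ℂ)) (t : ℝ) : ‖IccExtend hL f t‖ ≤ ‖f‖ :=
  f.norm_coe_le_norm _

theorem intervalIntegrable_mul_IccExtend (hg : IntervalIntegrable g volume 0 L)
    (f : (Icc 0 L →ᵇ ℂ)) : IntervalIntegrable (fun t => g t * IccExtend hL f t) volume 0 L :=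
  hg.mul_continuousOn (continuous_IccExtend_coe hL f).continuousOn

theorem intervalIntegrable_of_mem (hg : IntervalIntegrable g volume 0 L) (x : Icc 0 L) :
    IntervalIntegrable g volume 0 x := by
  refine hg.mono_set (uIcc_subset_uIcc (by simp) ?_)
  rw [uIcc_of_le (x.2.1.trans x.2.2)]
  exact x.2

/-- The Volterra operator `f ↦ ∫₀ˣ g f` on continuous functions on `[0, L]`. -/
noncomputable def volterra (hg : IntervalIntegrable g volume 0 L) :
    (Icc 0 L →ᵇ ℂ) →L[ℂ] (Icc 0 L →ᵇ ℂ) :=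
  LinearMap.mkContinuous
    { toFun := fun f => .mkOfCompact
        ⟨fun x : Icc 0 L => ∫ t in (0 : ℝ)..x, g t * IccExtend hL f t, by
        have h := continuousOn_primitive_interval (μ := volume)
          (f := fun t => g t * IccExtend hL f t) (a := 0) (b := L) (by
            rw [uIcc_of_le hL]
            exact (intervalIntegrable_iff_integrableOn_Icc_of_le hL).1
              (intervalIntegrable_mul_IccExtend hL hg f))
        rw [uIcc_of_le hL] at h
        exact h.domRestrict⟩
      map_add' := fun f₁ f₂ => by
        ext x
        refine Eq.trans ?_ (integral_add
          (intervalIntegrable_of_mem (intervalIntegrable_mul_IccExtend hL hg f₁) x)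
          (intervalIntegrable_of_mem (intervalIntegrable_mul_IccExtend hL hg f₂) x))
        refine integral_congr fun t _ => ?_
        simp [IccExtend, mul_add]
      map_smul' := fun a f => by
        ext x
        refine Eq.trans ?_ (intervalIntegral.integral_const_mul a _)
        refine integral_congr fun t _ => ?_
        simp only [IccExtend, Function.comp_apply, BoundedContinuousFunction.smul_apply,
          smul_eq_mul]
        ring } (∫ t in (0 : ℝ)..L, ‖g t‖) <| fun f => by
    refine (BoundedContinuousFunction.norm_le
      (mul_nonneg (integral_nonneg hL fun _ _ => norm_nonneg _)
      (norm_nonneg _))).2 fun x => ?_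
    have hgx := intervalIntegrable_of_mem hg x
    refine (norm_integral_le_of_norm_le x.2.1 (g := fun t => ‖g t‖ * ‖f‖)
      (Eventually.of_forall fun t _ => ?_) (hgx.norm.mul_const _)).trans ?_
    · rw [norm_mul]
      exact mul_le_mul_of_nonneg_left (norm_IccExtend_le hL f t) (norm_nonneg _)
    · rw [intervalIntegral.integral_mul_const]
      exact mul_le_mul_of_nonneg_right (integral_mono_interval le_rfl x.2.1 x.2.2
        (Eventually.of_forall fun _ => norm_nonneg _) hg.norm) (norm_nonneg _)

theorem volterra_apply (hg : IntervalIntegrable g volume 0 L) (f : (Icc 0 L →ᵇ ℂ))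
    (x : Icc 0 L) : volterra hL hg f x = ∫ t in (0 : ℝ)..x, g t * IccExtend hL f t := rfl

theorem norm_volterra_le (hg : IntervalIntegrable g volume 0 L) :
    ‖volterra hL hg‖ ≤ ∫ t in (0 : ℝ)..L, ‖g t‖ :=
  LinearMap.mkContinuous_norm_le _ (integral_nonneg hL fun _ _ => norm_nonneg _) _

theorem volterra_sub (hg₁ : IntervalIntegrable g₁ volume 0 L)
    (hg₂ : IntervalIntegrable g₂ volume 0 L) :
    volterra hL (hg₁.sub hg₂) = volterra hL hg₁ - volterra hL hg₂ := by
  ext f x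
  simp only [sub_apply, BoundedContinuousFunction.sub_apply, volterra_apply]
  rw [← integral_sub (intervalIntegrable_of_mem (intervalIntegrable_mul_IccExtend hL hg₁ f) x)
    (intervalIntegrable_of_mem (intervalIntegrable_mul_IccExtend hL hg₂ f) x)]
  simp [sub_mul]

/-- Integration `f ↦ ∫₀ˣ f`. -/
noncomputable def volterraOne : (Icc 0 L →ᵇ ℂ) →L[ℂ] (Icc 0 L →ᵇ ℂ) :=
  volterra hL (g := fun _ => 1) intervalIntegrable_const

theorem volterra_sub_const (hq : IntervalIntegrable q volume 0 L) (E : ℂ) :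
    volterra hL (hq.sub (intervalIntegrable_const (c := E))) =
      volterra hL hq - E • volterraOne hL := by
  rw [volterra_sub hL hq intervalIntegrable_const]
  congr 1
  ext f x
  simp [volterraOne, volterra_apply]

/-- Multiplication by `exp (r x)`. -/
noncomputable def expMul (L r : ℝ) : (Icc 0 L →ᵇ ℂ) →L[ℂ] (Icc 0 L →ᵇ ℂ) :=
  ContinuousLinearMap.mul ℂ (Icc 0 L →ᵇ ℂ)
    (.mkOfCompact ⟨fun x => (Real.exp (r * x) : ℂ), by fun_prop⟩)

theorem expMul_apply (r : ℝ) (f : (Icc 0 L →ᵇ ℂ)) (x : Icc 0 L) :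
    expMul L r f x = Real.exp (r * x) * f x := rfl

theorem expMul_mul_expMul_neg (r : ℝ) : expMul L r * expMul L (-r) = 1 := by
  ext f x
  simp only [mul_apply_eq_comp, expMul_apply, one_apply_eq_self]
  rw [← mul_assoc, ← Complex.ofReal_mul, ← Real.exp_add]
  simp

/-- Conjugation by exp(rx) amounts to a weighted sup norm: the kernel gains the factor exp(-r(x -
t)), which for r > 0 damps the contribution of t far below x. -/
theorem norm_conj_volterra_apply_le (hg : IntervalIntegrable g volume 0 L) (r : ℝ)
    (f : (Icc 0 L →ᵇ ℂ)) (x : Icc 0 L) :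
    ‖(expMul L (-r) * volterra hL hg * expMul L r) f x‖ ≤
      (∫ t in (0 : ℝ)..x, Real.exp (-r * (x - t)) * ‖g t‖) * ‖f‖ := by
  simp only [mul_apply_eq_comp, expMul_apply, volterra_apply]
  rw [← intervalIntegral.integral_const_mul, ← intervalIntegral.integral_mul_const]
  have hgx := intervalIntegrable_of_mem hg x
  refine norm_integral_le_of_norm_le x.2.1 ?_ ?_
  · refine Eventually.of_forall fun t ht => ?_
    have ht' : t ∈ Icc 0 L := ⟨ht.1.le, ht.2.trans x.2.2⟩
    rw [IccExtend_of_mem hL _ ht', expMul_apply, norm_mul, norm_mul, norm_mul,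
      Complex.norm_real, Complex.norm_real, Real.norm_eq_abs, Real.norm_eq_abs,
      Real.abs_exp, Real.abs_exp]
    have h1 : Real.exp (-r * (x - t)) = Real.exp (-r * x) * Real.exp (r * t) := by
      rw [← Real.exp_add]; ring_nf
    rw [h1]
    have h2 : ‖f ⟨t, ht'⟩‖ ≤ ‖f‖ := f.norm_coe_le_norm _
    calc _ = Real.exp (-r * x) * Real.exp (r * t) * ‖g t‖ * ‖f ⟨t, ht'⟩‖ := by ring
      _ ≤ _ := mul_le_mul_of_nonneg_left h2 (by positivity)
  · exact (hgx.norm.continuousOn_mul (by fun_prop)).mul_const _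

theorem integral_exp_neg_le {r x : ℝ} (hr : 0 < r) :
    ∫ t in (0 : ℝ)..x, Real.exp (-r * (x - t)) ≤ 1 / r := by
  have h : ∀ t, HasDerivAt (fun t => Real.exp (-r * (x - t)) / r) (Real.exp (-r * (x - t))) t := by
    intro t
    have h1 : HasDerivAt (fun t => -r * (x - t)) r t := by
      simpa using ((hasDerivAt_id t).const_sub x).const_mul (-r)
    have h2 := (h1.exp).div_const r
    rwa [mul_div_assoc, div_self hr.ne', mul_one] at h2
  rw [integral_eq_sub_of_hasDerivAt (fun t _ => h t)
    (Continuous.intervalIntegrable (by fun_prop) _ _)]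
  have : 0 < Real.exp (-r * (x - 0)) / r := by positivity
  simp only [sub_self, mul_zero, Real.exp_zero]
  linarith

/-- In the weighted norm plain integration has norm at most 1/r, while the operator with kernel g
keeps norm at most I. For large r the Neumann series converges, with no smallness assumed on g or L.
-/
theorem isUnit_one_sub_volterraOne_mul (hg : IntervalIntegrable g volume 0 L) :
    IsUnit (1 - volterraOne hL * volterra hL hg) := by
  set I := ∫ t in (0 : ℝ)..L, ‖g t‖ with hI
  have hI0 : 0 ≤ I := integral_nonneg hL fun _ _ => norm_nonneg _
  -- Any r > I would do, as the product has norm at most I/r.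
  set r := I + 1 with hr
  have hr0 : 0 < r := by linarith
  have h1 : ‖expMul L (-r) * volterraOne hL * expMul L r‖ ≤ 1 / r := by
    refine ContinuousLinearMap.opNorm_le_bound _ (by positivity) fun f => ?_
    refine (BoundedContinuousFunction.norm_le (by positivity)).2 fun x => ?_
    refine (norm_conj_volterra_apply_le hL _ r f x).trans ?_
    refine mul_le_mul_of_nonneg_right ?_ (norm_nonneg _)
    simpa using integral_exp_neg_le (x := x) hr0
  have h2 : ‖expMul L (-r) * volterra hL hg * expMul L r‖ ≤ I := by
    refine ContinuousLinearMap.opNorm_le_bound _ hI0 fun f => ?_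
    refine (BoundedContinuousFunction.norm_le (by positivity)).2 fun x => ?_
    refine (norm_conj_volterra_apply_le hL hg r f x).trans ?_
    refine mul_le_mul_of_nonneg_right ?_ (norm_nonneg _)
    have hgx := intervalIntegrable_of_mem hg x
    refine (integral_mono_on x.2.1 (hgx.norm.continuousOn_mul (by fun_prop)) hgx.norm
      fun t ht => ?_).trans (integral_mono_interval le_rfl x.2.1 x.2.2
        (Eventually.of_forall fun _ => norm_nonneg _) hg.norm)
    refine mul_le_of_le_one_left (norm_nonneg _) (Real.exp_le_one_iff.2 ?_)
    have := ht.2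
    nlinarith
  have h3 := expMul_mul_expMul_neg (L := L) r
  have h4 := expMul_mul_expMul_neg (L := L) (-r)
  rw [neg_neg] at h4
  set A := (expMul L (-r) * volterraOne hL * expMul L r) *
    (expMul L (-r) * volterra hL hg * expMul L r) with hA
  have hA1 : ‖A‖ < 1 := by
    refine (norm_mul_le _ _).trans_lt ?_
    calc _ ≤ 1 / r * I := mul_le_mul h1 h2 (norm_nonneg _) (by positivity)
      _ < 1 := by rw [one_div, inv_mul_lt_iff₀ hr0]; linarith
  have hU : IsUnit (expMul L r) := ⟨⟨_, _, h3, h4⟩, rfl⟩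
  have hU' : IsUnit (expMul L (-r)) := ⟨⟨_, _, h4, h3⟩, rfl⟩
  have key : 1 - volterraOne hL * volterra hL hg = expMul L r * (1 - A) * expMul L (-r) := by
    have : expMul L r * A * expMul L (-r) = (expMul L r * expMul L (-r)) * volterraOne hL *
        (expMul L r * expMul L (-r)) * volterra hL hg * (expMul L r * expMul L (-r)) := by
      simp only [hA, mul_assoc]
    rw [mul_sub, sub_mul, this, mul_one, h3]
    simp
  rw [key]
  exact (hU.mul (isUnit_one_sub_clm hA1)).mul hU'

/-- The operator `T` such that the Schrödinger equation with Cauchy data `(a, b)` at `0`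
reads `T u = a + b x`. -/
noncomputable def schrodingerOp (hq : IntervalIntegrable q volume 0 L) (E : ℂ) :
    (Icc 0 L →ᵇ ℂ) →L[ℂ] (Icc 0 L →ᵇ ℂ) :=
  1 - volterraOne hL * (volterra hL hq - E • volterraOne hL)

theorem isUnit_schrodingerOp (hq : IntervalIntegrable q volume 0 L) (E : ℂ) :
    IsUnit (schrodingerOp hL hq E) := by
  rw [schrodingerOp, ← volterra_sub_const]
  exact isUnit_one_sub_volterraOne_mul hL _

/-- The function `a + b x`. -/
noncomputable def affineMap (L : ℝ) (a b : ℂ) : (Icc 0 L →ᵇ ℂ) :=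
  .mkOfCompact ⟨fun x => a + b * (x : ℝ), by fun_prop⟩

/-- The solution with Cauchy data `(a, b)` at `0`. -/
noncomputable def solution (hq : IntervalIntegrable q volume 0 L) (E a b : ℂ) :
    (Icc 0 L →ᵇ ℂ) :=
  Ring.inverse (schrodingerOp hL hq E) (affineMap L a b)

/-- The derivative of the solution with Cauchy data `(a, b)` at `0`. -/
noncomputable def solutionDeriv (hq : IntervalIntegrable q volume 0 L) (E a b : ℂ) :
    (Icc 0 L →ᵇ ℂ) :=
  affineMap L b 0 + (volterra hL hq - E • volterraOne hL) (solution hL hq E a b)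

theorem solution_eq (hq : IntervalIntegrable q volume 0 L) (E a b : ℂ) :
    solution hL hq E a b = affineMap L a 0 + volterraOne hL (solutionDeriv hL hq E a b) := by
  have h : schrodingerOp hL hq E (solution hL hq E a b) = affineMap L a b := by
    have := Ring.mul_inverse_cancel _ (isUnit_schrodingerOp hL hq E)
    exact congrArg (fun T : (Icc 0 L →ᵇ ℂ) →L[ℂ] (Icc 0 L →ᵇ ℂ) => T (affineMap L a b)) this
  have h2 : affineMap L a b = affineMap L a 0 + volterraOne hL (affineMap L b 0) := by
    ext x
    simp [affineMap, volterraOne, volterra_apply, IccExtend, mul_comm]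
  rw [solutionDeriv, map_add, ← add_assoc, ← h2, ← h, schrodingerOp]
  simp

theorem isSchrodinger_solution (hq : IntervalIntegrable q volume 0 L) (E a b : ℂ) :
    IsSchrodinger L q E (IccExtend hL (solution hL hq E a b))
      (IccExtend hL (solutionDeriv hL hq E a b)) := by
  have h0 : (0 : ℝ) ∈ Icc 0 L := ⟨le_rfl, hL⟩
  constructor
  · refine ⟨(continuous_IccExtend_coe hL _).intervalIntegrable _ _, fun x hx => ?_⟩
    have h : ∀ x (hx : x ∈ Icc 0 L), IccExtend hL (solution hL hq E a b) x =
        a + ∫ t in (0 : ℝ)..x, IccExtend hL (solutionDeriv hL hq E a b) t := by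
      intro x hx
      rw [IccExtend_of_mem hL _ hx, solution_eq]
      simp [affineMap, volterraOne, volterra_apply]
    rw [h x hx, h 0 h0]
    simp
  · have hi := intervalIntegrable_mul_IccExtend hL
      (hq.sub (intervalIntegrable_const (c := E))) (solution hL hq E a b)
    refine ⟨hi, fun x hx => ?_⟩
    have h : ∀ x (hx : x ∈ Icc 0 L), IccExtend hL (solutionDeriv hL hq E a b) x =
        b + ∫ t in (0 : ℝ)..x, (q t - E) * IccExtend hL (solution hL hq E a b) t := by
      intro x hx
      rw [IccExtend_of_mem hL _ hx, solutionDeriv, ← volterra_sub_const]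
      simp [affineMap, volterra_apply]
    rw [h x hx, h 0 h0]
    simp

theorem solution_zero (hq : IntervalIntegrable q volume 0 L) (E a b : ℂ) :
    IccExtend hL (solution hL hq E a b) 0 = a := by
  rw [IccExtend_of_mem hL _ ⟨le_rfl, hL⟩, solution_eq]
  simp [affineMap, volterraOne, volterra_apply]

theorem solutionDeriv_zero (hq : IntervalIntegrable q volume 0 L) (E a b : ℂ) :
    IccExtend hL (solutionDeriv hL hq E a b) 0 = b := by
  rw [IccExtend_of_mem hL _ ⟨le_rfl, hL⟩, solutionDeriv]
  simp [affineMap, volterraOne, volterra_apply]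

theorem isFundamental_solution (hq : IntervalIntegrable q volume 0 L) (E : ℂ) :
    IsFundamental L q E (IccExtend hL (solution hL hq E 1 0))
      (IccExtend hL (solutionDeriv hL hq E 1 0)) (IccExtend hL (solution hL hq E 0 1))
      (IccExtend hL (solutionDeriv hL hq E 0 1)) :=
  ⟨isSchrodinger_solution hL hq E 1 0, isSchrodinger_solution hL hq E 0 1,
    solution_zero hL hq E 1 0, solutionDeriv_zero hL hq E 1 0,
    solution_zero hL hq E 0 1, solutionDeriv_zero hL hq E 0 1⟩

/-- The operator is affine in E and invertible for every E, and inversion is analytic on the units.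
-/
theorem differentiable_solution (hq : IntervalIntegrable q volume 0 L) (a b : ℂ) :
    Differentiable ℂ fun E => solution hL hq E a b := by
  have h : Differentiable ℂ fun E => schrodingerOp hL hq E := by
    have h2 := differentiable_add_smul (1 - volterraOne hL * volterra hL hq)
      (volterraOne hL * volterraOne hL)
    refine (congrArg (Differentiable ℂ) (funext fun E => ?_)).mp h2
    ext f x
    simp [schrodingerOp, sub_add]
  exact (differentiable_inverse_clm h (isUnit_schrodingerOp hL hq)).clm_apply
    (differentiable_const _)

theorem differentiable_solutionDeriv (hq : IntervalIntegrable q volume 0 L) (a b : ℂ) :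
    Differentiable ℂ fun E => solutionDeriv hL hq E a b := by
  refine (differentiable_const _).add (Differentiable.clm_apply (by fun_prop)
    (differentiable_solution hL hq a b))

theorem differentiable_IccExtend {f : ℂ → (Icc 0 L →ᵇ ℂ)} (hf : Differentiable ℂ f) (x : ℝ) :
    Differentiable ℂ fun E => IccExtend hL (f E) x :=
  differentiable_clm_comp (BoundedContinuousFunction.evalCLM ℂ (projIcc 0 L hL x)) hf

variable {ι : Type*} {l : Filter ι} {p : ι → ℝ → ℂ}

theorem tendsto_volterra (hp : ∀ i, IntervalIntegrable (p i) volume 0 L)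
    (hq : IntervalIntegrable q volume 0 L)
    (h : Tendsto (fun i => ∫ t in (0 : ℝ)..L, ‖p i t - q t‖) l (𝓝 0)) :
    Tendsto (fun i => volterra hL (hp i)) l (𝓝 (volterra hL hq)) := by
  rw [tendsto_iff_norm_sub_tendsto_zero]
  refine squeeze_zero (fun _ => norm_nonneg _) (fun i => ?_) h
  rw [← volterra_sub]
  exact norm_volterra_le hL _

/-- The Volterra operator is linear in the potential with norm at most its L¹ norm, and inversion is
continuous at units. -/
theorem tendsto_solution (hp : ∀ i, IntervalIntegrable (p i) volume 0 L)
    (hq : IntervalIntegrable q volume 0 L)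
    (h : Tendsto (fun i => ∫ t in (0 : ℝ)..L, ‖p i t - q t‖) l (𝓝 0)) (E a b : ℂ) :
    Tendsto (fun i => solution hL (hp i) E a b) l (𝓝 (solution hL hq E a b)) := by
  have h1 : Tendsto (fun i => schrodingerOp hL (hp i) E) l (𝓝 (schrodingerOp hL hq E)) :=
    tendsto_const_nhds.sub (tendsto_const_nhds.mul
      ((tendsto_volterra hL hp hq h).sub tendsto_const_nhds))
  exact tendsto_clm_apply (tendsto_inverse_clm h1 (isUnit_schrodingerOp hL hq E))
    tendsto_const_nhds

theorem tendsto_solutionDeriv (hp : ∀ i, IntervalIntegrable (p i) volume 0 L)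
    (hq : IntervalIntegrable q volume 0 L)
    (h : Tendsto (fun i => ∫ t in (0 : ℝ)..L, ‖p i t - q t‖) l (𝓝 0)) (E a b : ℂ) :
    Tendsto (fun i => solutionDeriv hL (hp i) E a b) l (𝓝 (solutionDeriv hL hq E a b)) :=
  tendsto_const_nhds.add (tendsto_clm_apply
    ((tendsto_volterra hL hp hq h).sub tendsto_const_nhds) (tendsto_solution hL hp hq h E a b))

end Volterra

/-! ### High-energy asymptotics -/

section Asymptotics

variable {L : ℝ} {q u u' : ℝ → ℂ} {κ : ℂ}

theorem hasIntegralDeriv_cexp (L : ℝ) (z : ℂ) :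
    HasIntegralDeriv L (fun x => Complex.exp (z * x)) (fun x => z * Complex.exp (z * x)) := by
  refine HasIntegralDeriv.of_hasDerivAt (fun x => ?_) (by fun_prop)
  have h1 : HasDerivAt (fun x : ℝ => z * (x : ℂ)) z x := by
    simpa using (Complex.ofRealCLM.hasDerivAt (x := x)).const_mul z
  simpa [mul_comm] using h1.cexp

theorem norm_integral_mul_le (hq : IntervalIntegrable q volume 0 L) {f : ℝ → ℂ} {S : ℝ}
    (hS : 0 ≤ S) {x : ℝ} (hx : x ∈ Icc 0 L) (hf : ∀ t ∈ Ioc 0 x, ‖f t‖ ≤ ‖q t‖ * S) :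
    ‖∫ t in (0 : ℝ)..x, f t‖ ≤ (∫ t in (0 : ℝ)..L, ‖q t‖) * S := by
  have hqx := intervalIntegrable_of_mem hq ⟨x, hx⟩
  refine (norm_integral_le_of_norm_le hx.1 (Eventually.of_forall hf)
    (hqx.norm.mul_const S)).trans ?_
  rw [intervalIntegral.integral_mul_const]
  exact mul_le_mul_of_nonneg_right (integral_mono_interval le_rfl hx.1 hx.2
    (Eventually.of_forall fun _ => norm_nonneg _) hq.norm) hS

/-- High-energy asymptotics of the solution with Cauchy data `(1, κ)` at energy `-κ²`, uniformly
in the closed half-plane `Re κ ≥ 0`. -/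
theorem IsSchrodinger.norm_exp_mul_sub_one_le (hL : 0 ≤ L)
    (hq : IntervalIntegrable q volume 0 L) (hκ : 0 ≤ κ.re) (hκ0 : κ ≠ 0)
    (hκq : 2 * (∫ t in (0 : ℝ)..L, ‖q t‖) ≤ ‖κ‖) (hu : IsSchrodinger L q (-κ ^ 2) u u')
    (hu0 : u 0 = 1) (hu'0 : u' 0 = κ) {x : ℝ} (hx : x ∈ Icc 0 L) :
    ‖Complex.exp (-κ * x) * u x - 1‖ ≤ 2 * (∫ t in (0 : ℝ)..L, ‖q t‖) / ‖κ‖ ∧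
      ‖Complex.exp (-κ * x) * (u' x / κ) - 1‖ ≤ 2 * (∫ t in (0 : ℝ)..L, ‖q t‖) / ‖κ‖ := by
  set Q := ∫ t in (0 : ℝ)..L, ‖q t‖ with hQ
  have hQ0 : 0 ≤ Q := integral_nonneg hL fun _ _ => norm_nonneg _
  have hκpos : 0 < ‖κ‖ := norm_pos_iff.2 hκ0
  set h : ℝ → ℂ := fun x => Complex.exp (-κ * x) * u x with hh
  have hcont : ContinuousOn h (Icc 0 L) :=
    (Continuous.continuousOn (by fun_prop)).mul hu.deriv.continuousOn
  -- The maximum S of |exp(-κx)u| bounds both components by Q S; that S ≤ 2 is recovered afterwards.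
  obtain ⟨y, hy, hymax⟩ := isCompact_Icc.exists_isMaxOn ⟨x, hx⟩ hcont.norm
  set S := ‖h y‖ with hS
  have hS0 : 0 ≤ S := norm_nonneg _
  have hle : ∀ t ∈ Icc 0 L, ‖h t‖ ≤ S := fun t ht => hymax ht
  -- the growing component
  have hα := (hasIntegralDeriv_cexp L (-κ)).mul hL
    (hu.deriv_deriv.add (hu.deriv.const_mul κ))
  -- the decaying component
  have hβ := (hasIntegralDeriv_cexp L κ).mul hL
    (hu.deriv_deriv.sub (hu.deriv.const_mul κ))
  have hαx : ∀ x ∈ Icc 0 L, ‖Complex.exp (-κ * x) * (u' x + κ * u x) - 2 * κ‖ ≤ Q * S := by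
    intro x hx
    have h1 := hα.eq_add x hx
    rw [h1]
    simp only [Complex.ofReal_zero, mul_zero, Complex.exp_zero, hu0, hu'0]
    rw [show ∀ I : ℂ, 1 * (κ + κ * 1) + I - 2 * κ = I from fun I => by ring]
    refine norm_integral_mul_le hq hS0 hx fun t ht => ?_
    have h2 : -κ * Complex.exp (-κ * t) * (u' t + κ * u t) +
        Complex.exp (-κ * t) * ((q t - -κ ^ 2) * u t + κ * u' t) = q t * h t := by
      simp only [hh]; ring
    rw [h2, norm_mul]
    exact mul_le_mul_of_nonneg_left (hle t ⟨ht.1.le, ht.2.trans hx.2⟩) (norm_nonneg _)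
  have hβx : ∀ x ∈ Icc 0 L, ‖Complex.exp (-κ * x) * (u' x - κ * u x)‖ ≤ Q * S := by
    intro x hx
    have h1 := hβ.eq_add x hx
    simp only [Complex.ofReal_zero, mul_zero, Complex.exp_zero, hu0, hu'0, mul_one, sub_self,
      zero_add] at h1
    -- The factor exp(-2κx) enters the integral and forms the kernel exp(-2κ(x - t)), bounded by 1
    -- since Re κ ≥ 0 and t ≤ x.
    have h3 : Complex.exp (-κ * x) * (u' x - κ * u x) =
        Complex.exp (-2 * κ * x) * (Complex.exp (κ * x) * (u' x - κ * u x)) := by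
      rw [← mul_assoc, ← Complex.exp_add]
      ring_nf
    rw [h3, h1, ← intervalIntegral.integral_const_mul]
    refine norm_integral_mul_le hq hS0 hx fun t ht => ?_
    have h2 : Complex.exp (-2 * κ * x) * (κ * Complex.exp (κ * t) * (u' t - κ * u t) +
        Complex.exp (κ * t) * ((q t - -κ ^ 2) * u t - κ * u' t)) =
        Complex.exp (-2 * κ * (x - t)) * (q t * h t) := by
      have h4 : Complex.exp (-2 * κ * x) * Complex.exp (κ * t) =
          Complex.exp (-2 * κ * (x - t)) * Complex.exp (-κ * t) := by
        rw [← Complex.exp_add, ← Complex.exp_add]; ring_nf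
      simp only [hh]
      linear_combination (q t * u t) * h4
    have h5 : ‖Complex.exp (-2 * κ * (x - t))‖ ≤ 1 := by
      rw [Complex.norm_exp]
      refine Real.exp_le_one_iff.2 ?_
      have h6 : (-2 * κ * (x - t)).re = -(2 * (κ.re * (x - t))) := by
        rw [show -2 * κ * (x - t) = ((-(2 * (x - t)) : ℝ) : ℂ) * κ by push_cast; ring,
          Complex.re_ofReal_mul]
        ring
      rw [h6]
      have := mul_nonneg hκ (sub_nonneg.2 ht.2)
      linarith
    rw [h2, norm_mul, norm_mul]
    have h7 := hle t ⟨ht.1.le, ht.2.trans hx.2⟩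
    calc _ ≤ 1 * (‖q t‖ * S) := by gcongr
      _ = _ := one_mul _
  have hκ2 : ‖2 * κ‖ = 2 * ‖κ‖ := by simp
  have hbound : ∀ a b : ℂ, ‖a‖ ≤ Q * S → ‖b‖ ≤ Q * S → ‖(a + b) / (2 * κ)‖ ≤ Q * S / ‖κ‖ := by
    intro a b ha hb
    rw [norm_div, hκ2, div_le_div_iff₀ (by positivity) hκpos]
    have := norm_add_le a b
    nlinarith
  have hux : ∀ x ∈ Icc 0 L, ‖h x - 1‖ ≤ Q * S / ‖κ‖ := by
    intro x hx
    have h1 := hbound _ (-(Complex.exp (-κ * x) * (u' x - κ * u x))) (hαx x hx)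
      (by rw [norm_neg]; exact hβx x hx)
    refine (congrArg norm ?_).trans_le h1
    simp only [hh]
    field_simp
    ring
  -- Bootstrap: 2Q ≤ ‖κ‖ turns the bound into S ≤ 1 + S/2.
  have hS2 : S ≤ 2 := by
    have h1 := hux y hy
    have h2 : S ≤ 1 + Q * S / ‖κ‖ := by
      have := norm_add_le (h y - 1) 1
      rw [sub_add_cancel, norm_one] at this
      linarith
    have h3 : Q * S / ‖κ‖ ≤ S / 2 := by
      rw [div_le_div_iff₀ hκpos two_pos]
      nlinarith
    linarith
  have hQS : Q * S / ‖κ‖ ≤ 2 * Q / ‖κ‖ := by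
    rw [mul_comm 2 Q]
    gcongr
  refine ⟨(hux x hx).trans hQS, ?_⟩
  refine le_trans ?_ hQS
  have h1 : Complex.exp (-κ * x) * (u' x / κ) - 1 =
      (Complex.exp (-κ * x) * (u' x + κ * u x) - 2 * κ +
        Complex.exp (-κ * x) * (u' x - κ * u x)) / (2 * κ) := by
    field_simp
    ring
  rw [h1]
  exact hbound _ _ (hαx x hx) (hβx x hx)

/-- High-energy asymptotics of the solution with Cauchy data `(1, -κ)` at the right end point. -/
theorem IsSchrodinger.norm_exp_mul_sub_one_le_of_right (hL : 0 ≤ L)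
    (hq : IntervalIntegrable q volume 0 L) (hκ : 0 ≤ κ.re) (hκ0 : κ ≠ 0)
    (hκq : 2 * (∫ t in (0 : ℝ)..L, ‖q t‖) ≤ ‖κ‖) (hu : IsSchrodinger L q (-κ ^ 2) u u')
    (huL : u L = 1) (hu'L : u' L = -κ) {x : ℝ} (hx : x ∈ Icc 0 L) :
    ‖Complex.exp (-κ * (L - x)) * u x - 1‖ ≤ 2 * (∫ t in (0 : ℝ)..L, ‖q t‖) / ‖κ‖ ∧
      ‖Complex.exp (-κ * (L - x)) * (u' x / κ) - -1‖ ≤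
        2 * (∫ t in (0 : ℝ)..L, ‖q t‖) / ‖κ‖ := by
  have hq' : IntervalIntegrable (fun x => q (L - x)) volume 0 L := by
    simpa using (hq.comp_sub_left L).symm
  have hQ : ∫ t in (0 : ℝ)..L, ‖q (L - t)‖ = ∫ t in (0 : ℝ)..L, ‖q t‖ := by
    rw [integral_comp_sub_left (fun t => ‖q t‖)]
    simp
  have h := hu.reflect.norm_exp_mul_sub_one_le hL hq' hκ hκ0 (by rwa [hQ]) (by simpa using huL)
    (by simp [hu'L]) (x := L - x) ⟨by linarith [hx.2], by linarith [hx.1]⟩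
  rw [hQ] at h
  simp only [sub_sub_cancel, Complex.ofReal_sub] at h
  refine ⟨h.1, ?_⟩
  rw [← norm_neg]
  refine (congrArg norm ?_).trans_le h.2
  ring

/-- The trace of the transfer matrix at energy `k²` is `2 cos (k L) + O(1 / k)`. -/
theorem IsFundamental.norm_trace_sub_le {c c' s s' : ℝ → ℂ} (hL : 0 ≤ L)
    (hq : IntervalIntegrable q volume 0 L) {k : ℝ} (hk : 0 < k)
    (hkq : 2 * (∫ t in (0 : ℝ)..L, ‖q t‖) ≤ k)
    (h : IsFundamental L q ((k ^ 2 : ℝ) : ℂ) c c' s s') :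
    ‖c L + s' L - 2 * Complex.cos (k * L)‖ ≤ 4 * (∫ t in (0 : ℝ)..L, ‖q t‖) / k := by
  have hLL : L ∈ Icc 0 L := ⟨hL, le_rfl⟩
  have hk0 : (k : ℂ) ≠ 0 := by exact_mod_cast hk.ne'
  -- The values σ = ±i give κ = ±ik, both on the line Re κ = 0 and with -κ² = k². The two resulting
  -- solutions together determine the trace.
  have key : ∀ σ : ℂ, σ ^ 2 = -1 → σ.re = 0 → ‖σ‖ = 1 →
      ‖Complex.exp (-(σ * k) * L) * (c L + σ * k * s L) - 1‖ ≤
        2 * (∫ t in (0 : ℝ)..L, ‖q t‖) / k ∧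
      ‖Complex.exp (-(σ * k) * L) * ((c' L + σ * k * s' L) / (σ * k)) - 1‖ ≤
        2 * (∫ t in (0 : ℝ)..L, ‖q t‖) / k := by
    intro σ hσ hre hnorm
    have hE : -(σ * k) ^ 2 = ((k ^ 2 : ℝ) : ℂ) := by
      rw [mul_pow, hσ]; push_cast; ring
    have hn : ‖σ * k‖ = k := by simp [hnorm, abs_of_pos hk]
    have hσ0 : σ ≠ 0 := by rintro rfl; simp at hnorm
    have hu := h.cos.linearCombination h.sin 1 (σ * k)
    rw [← hE] at hu
    have := hu.norm_exp_mul_sub_one_le hL hq (by simp [hre]) (mul_ne_zero hσ0 hk0)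
      (by rwa [hn]) (by simp [h.cos_zero, h.sin_zero])
      (by simp [h.cos_deriv_zero, h.sin_deriv_zero]) hLL
    rw [hn] at this
    simpa only [one_mul] using this
  obtain ⟨h1, h2⟩ := key Complex.I (by simp) (by simp) (by simp)
  obtain ⟨h3, h4⟩ := key (-Complex.I) (by simp) (by simp) (by simp)
  have hn : ∀ r : ℝ, ‖Complex.exp (Complex.I * k * r)‖ = 1 := fun r => by
    rw [show Complex.I * k * r = ((k * r : ℝ) : ℂ) * Complex.I by push_cast; ring,
      Complex.norm_exp_ofReal_mul_I]
  set e := Complex.exp (Complex.I * k * L) with he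
  have hee : e ≠ 0 := Complex.exp_ne_zero _
  have h5 : Complex.exp (-(Complex.I * k) * L) = e⁻¹ := by
    rw [he, ← Complex.exp_neg]; ring_nf
  have h6 : Complex.exp (-(-Complex.I * k) * L) = e := by
    rw [he]; ring_nf
  have h7 : 2 * Complex.cos (k * L) = e + e⁻¹ := by
    rw [he, ← Complex.exp_neg, Complex.two_cos]; ring_nf
  rw [h5] at h1 h2
  rw [h6] at h3 h4
  set G₁ := e⁻¹ * (c L + Complex.I * k * s L) - 1 with hG₁
  set G₂ := e⁻¹ * ((c' L + Complex.I * k * s' L) / (Complex.I * k)) - 1 with hG₂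
  set G₃ := e * (c L + -Complex.I * k * s L) - 1 with hG₃
  set G₄ := e * ((c' L + -Complex.I * k * s' L) / (-Complex.I * k)) - 1 with hG₄
  have h8 : c L + s' L - 2 * Complex.cos (k * L) =
      (e * G₁ + e * G₂ + e⁻¹ * G₃ + e⁻¹ * G₄) / 2 := by
    rw [h7, hG₁, hG₂, hG₃, hG₄]
    have hI := Complex.I_ne_zero
    field_simp
    ring
  have hne : ‖e‖ = 1 := hn L
  have hne' : ‖e⁻¹‖ = 1 := by rw [norm_inv, hne, inv_one]
  rw [h8, norm_div]
  have h9 := norm_add₄_le (a := e * G₁) (b := e * G₂) (c := e⁻¹ * G₃) (d := e⁻¹ * G₄)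
  simp only [norm_mul, hne, hne', one_mul] at h9
  have h10 : 4 * (∫ t in (0 : ℝ)..L, ‖q t‖) / k = 2 * (2 * (∫ t in (0 : ℝ)..L, ‖q t‖) / k) := by
    ring
  rw [h10, Complex.norm_ofNat]
  linarith

end Asymptotics

/-! ### Borg-type uniqueness -/

section InverseProblem

theorem exists_sq_eq_re_nonneg (z : ℂ) : ∃ κ : ℂ, κ ^ 2 = z ∧ 0 ≤ κ.re := by
  obtain ⟨κ, hκ⟩ := IsAlgClosed.exists_pow_nat_eq z (n := 2) two_pos
  rcases le_total 0 κ.re with h | h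
  · exact ⟨κ, hκ, h⟩
  · exact ⟨-κ, by rw [neg_sq, hκ], by simpa using h⟩

variable {L : ℝ} {q₁ q₂ : ℝ → ℂ}

theorem HasIntegralDeriv.ae_unique (hL : 0 ≤ L) {F f g : ℝ → ℂ} (h₁ : HasIntegralDeriv L F f)
    (h₂ : HasIntegralDeriv L F g) : ∀ᵐ x, x ∈ Icc 0 L → f x = g x := by
  filter_upwards [h₁.ae_hasDerivAt hL, h₂.ae_hasDerivAt hL] with x hx₁ hx₂ hx
  exact (hx₁ hx).unique (hx₂ hx)

theorem HasIntegralDeriv.eqOn_of_continuousOn (hL : 0 < L) {F f g : ℝ → ℂ}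
    (h₁ : HasIntegralDeriv L F f) (h₂ : HasIntegralDeriv L F g) (hf : ContinuousOn f (Icc 0 L))
    (hg : ContinuousOn g (Icc 0 L)) : EqOn f g (Icc 0 L) := by
  refine Measure.eqOn_Icc_of_ae_eq volume hL.ne ?_ hf hg
  exact (ae_restrict_iff' measurableSet_Icc).2 (h₁.ae_unique hL.le h₂)

/-- Two potentials with the same solutions with Cauchy data `(1, 0)` and `(0, 1)` agree. -/
theorem IsFundamental.potential_ae_eq (hL : 0 < L) {E : ℂ}
    {c₁ c₁' s₁ s₁' c₂ c₂' s₂ s₂' : ℝ → ℂ} (h₁ : IsFundamental L q₁ E c₁ c₁' s₁ s₁')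
    (h₂ : IsFundamental L q₂ E c₂ c₂' s₂ s₂') (hc : ∀ x ∈ Icc 0 L, c₁ x = c₂ x)
    (hs : ∀ x ∈ Icc 0 L, s₁ x = s₂ x) : ∀ᵐ x, x ∈ Icc 0 L → q₁ x = q₂ x := by
  have key : ∀ {u₁ u₁' u₂ u₂' : ℝ → ℂ}, IsSchrodinger L q₁ E u₁ u₁' →
      IsSchrodinger L q₂ E u₂ u₂' → (∀ x ∈ Icc 0 L, u₁ x = u₂ x) →
      ∀ᵐ x, x ∈ Icc 0 L → (q₁ x - q₂ x) * u₁ x = 0 := by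
    intro u₁ u₁' u₂ u₂' hu₁ hu₂ h
    have h' : EqOn u₁' u₂' (Icc 0 L) := hu₁.deriv.eqOn_of_continuousOn hL
      (hu₂.deriv.congr_fun fun x hx => (h x hx).symm) hu₁.deriv_deriv.continuousOn
      hu₂.deriv_deriv.continuousOn
    filter_upwards [hu₁.deriv_deriv.ae_unique hL.le
      (hu₂.deriv_deriv.congr_fun fun x hx => (h' hx).symm)] with x hx hxL
    have h1 := hx hxL
    rw [← h x hxL] at h1
    linear_combination h1
  filter_upwards [key h₁.cos h₂.cos hc, key h₁.sin h₂.sin hs] with x hx hx' hxL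
  have h1 := h₁.det_eq_one hL.le hxL
  have h2 := hx hxL
  have h3 := hx' hxL
  -- The difference q₁ - q₂ is annihilated by both c₁ and s₁, which have no common zero because
  -- their Wronskian is 1.
  linear_combination s₁' x * h2 - c₁' x * h3 - (q₁ x - q₂ x) * h1

/-- A Borg-type uniqueness theorem: the transfer matrices of a potential over `[0, L]` at all
complex energies determine the potential. -/
theorem ae_eq_of_forall_solution_eq (hL : 0 < L) (hq₁ : IntervalIntegrable q₁ volume 0 L)
    (hq₂ : IntervalIntegrable q₂ volume 0 L)
    (hc : ∀ E, IccExtend hL.le (solution hL.le hq₁ E 1 0) L =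
      IccExtend hL.le (solution hL.le hq₂ E 1 0) L)
    (hc' : ∀ E, IccExtend hL.le (solutionDeriv hL.le hq₁ E 1 0) L =
      IccExtend hL.le (solutionDeriv hL.le hq₂ E 1 0) L)
    (hs : ∀ E, IccExtend hL.le (solution hL.le hq₁ E 0 1) L =
      IccExtend hL.le (solution hL.le hq₂ E 0 1) L)
    (hs' : ∀ E, IccExtend hL.le (solutionDeriv hL.le hq₁ E 0 1) L =
      IccExtend hL.le (solutionDeriv hL.le hq₂ E 0 1) L) :
    ∀ᵐ x, x ∈ Icc 0 L → q₁ x = q₂ x := by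
  set c₁ : ℂ → ℝ → ℂ := fun E => IccExtend hL.le (solution hL.le hq₁ E 1 0) with hc₁
  set c₁' : ℂ → ℝ → ℂ := fun E => IccExtend hL.le (solutionDeriv hL.le hq₁ E 1 0) with hc₁'
  set s₁ : ℂ → ℝ → ℂ := fun E => IccExtend hL.le (solution hL.le hq₁ E 0 1) with hs₁
  set s₁' : ℂ → ℝ → ℂ := fun E => IccExtend hL.le (solutionDeriv hL.le hq₁ E 0 1) with hs₁'
  set c₂ : ℂ → ℝ → ℂ := fun E => IccExtend hL.le (solution hL.le hq₂ E 1 0) with hc₂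
  set c₂' : ℂ → ℝ → ℂ := fun E => IccExtend hL.le (solutionDeriv hL.le hq₂ E 1 0) with hc₂'
  set s₂ : ℂ → ℝ → ℂ := fun E => IccExtend hL.le (solution hL.le hq₂ E 0 1) with hs₂
  set s₂' : ℂ → ℝ → ℂ := fun E => IccExtend hL.le (solutionDeriv hL.le hq₂ E 0 1) with hs₂'
  have hF₁ : ∀ E, IsFundamental L q₁ E (c₁ E) (c₁' E) (s₁ E) (s₁' E) :=
    fun E => isFundamental_solution hL.le hq₁ E
  have hF₂ : ∀ E, IsFundamental L q₂ E (c₂ E) (c₂' E) (s₂ E) (s₂' E) :=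
    fun E => isFundamental_solution hL.le hq₂ E
  have hLL : L ∈ Icc 0 L := ⟨hL.le, le_rfl⟩
  -- A root with Re κ ≥ 0 exists for every complex E, so the estimates cover all directions at
  -- infinity. The choice need not be continuous in E.
  choose κ hκsq hκre using fun E : ℂ => exists_sq_eq_re_nonneg (-E)
  have hκE : ∀ E, -(κ E) ^ 2 = E := fun E => by rw [hκsq, neg_neg]
  have hκtop : Tendsto (fun E => ‖κ E‖) (cocompact ℂ) atTop := by
    have h : ∀ E, ‖κ E‖ = Real.sqrt ‖E‖ := fun E => by
      have := congrArg norm (hκsq E)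
      rw [norm_pow, norm_neg] at this
      rw [← this, Real.sqrt_sq (norm_nonneg _)]
    simp only [h]
    exact Real.tendsto_sqrt_atTop.comp tendsto_norm_cocompact_atTop
  have hsmall : ∀ Q : ℝ, Tendsto (fun E => 2 * Q / ‖κ E‖) (cocompact ℂ) (𝓝 0) := fun Q =>
    hκtop.const_div_atTop _
  have hlim : ∀ {Q : ℝ} {f : ℂ → ℂ} {z : ℂ},
      (∀ E, κ E ≠ 0 → 2 * Q ≤ ‖κ E‖ → ‖f E - z‖ ≤ 2 * Q / ‖κ E‖) →
      Tendsto f (cocompact ℂ) (𝓝 z) := by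
    intro Q f z h
    rw [tendsto_iff_norm_sub_tendsto_zero]
    refine squeeze_zero' (Eventually.of_forall fun _ => norm_nonneg _) ?_ (hsmall Q)
    filter_upwards [hκtop.eventually_ge_atTop (2 * Q), hκtop.eventually_gt_atTop 0] with E h1 h2
    exact h E (norm_pos_iff.1 h2) h1
  -- the matrix conjugating the two flows is the identity in its first row
  have hN : ∀ x ∈ Icc 0 L, ∀ E, c₁ E x * s₂' E x - s₁ E x * c₂' E x = 1 ∧
      s₁ E x * c₂ E x - c₁ E x * s₂ E x = 0 := by
    intro x hx
    set N₁ : ℂ → ℂ := fun E => c₁ E x * s₂' E x - s₁ E x * c₂' E x with hN₁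
    set N₂ : ℂ → ℂ := fun E => s₁ E x * c₂ E x - c₁ E x * s₂ E x with hN₂
    set e : ℂ → ℂ := fun E => Complex.exp (-κ E * x) with he
    set d : ℂ → ℂ := fun E => Complex.exp (-κ E * (L - x)) with hd
    -- A and B are the coefficients of the solution with data (1, -κ) at L.
    set A : ℂ → ℂ := fun E => s₁' E L + κ E * s₁ E L with hA
    set B : ℂ → ℂ := fun E => -κ E * c₁ E L - c₁' E L with hB
    have growing : ∀ {q : ℝ → ℂ} {c c' s s' : ℂ → ℝ → ℂ}, IntervalIntegrable q volume 0 L →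
        (∀ E, IsFundamental L q E (c E) (c' E) (s E) (s' E)) →
        Tendsto (fun E => e E * (c E x + κ E * s E x)) (cocompact ℂ) (𝓝 1) ∧
        Tendsto (fun E => e E * ((c' E x + κ E * s' E x) / κ E)) (cocompact ℂ) (𝓝 1) := by
      intro q c c' s s' hq hF
      have h : ∀ E, κ E ≠ 0 → 2 * (∫ t in (0 : ℝ)..L, ‖q t‖) ≤ ‖κ E‖ → _ := fun E h0 hb =>
        IsSchrodinger.norm_exp_mul_sub_one_le (u := fun x => 1 * c E x + κ E * s E x)
          (u' := fun x => 1 * c' E x + κ E * s' E x) hL.le hq (hκre E) h0 hb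
          (by rw [hκE]; exact (hF E).cos.linearCombination (hF E).sin 1 (κ E))
          (by simp [(hF E).cos_zero, (hF E).sin_zero])
          (by simp [(hF E).cos_deriv_zero, (hF E).sin_deriv_zero]) hx
      simp only [one_mul] at h
      exact ⟨hlim fun E h0 hb => (h E h0 hb).1, hlim fun E h0 hb => (h E h0 hb).2⟩
    have decaying : ∀ {q : ℝ → ℂ} {c c' s s' : ℂ → ℝ → ℂ}, IntervalIntegrable q volume 0 L →
        (∀ E, IsFundamental L q E (c E) (c' E) (s E) (s' E)) →
        (∀ E, A E * c E L + B E * s E L = 1) → (∀ E, A E * c' E L + B E * s' E L = -κ E) →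
        Tendsto (fun E => d E * (A E * c E x + B E * s E x)) (cocompact ℂ) (𝓝 1) ∧
        Tendsto (fun E => d E * ((A E * c' E x + B E * s' E x) / κ E)) (cocompact ℂ)
          (𝓝 (-1)) := by
      intro q c c' s s' hq hF h1 h2
      have h : ∀ E, κ E ≠ 0 → 2 * (∫ t in (0 : ℝ)..L, ‖q t‖) ≤ ‖κ E‖ → _ := fun E h0 hb =>
        IsSchrodinger.norm_exp_mul_sub_one_le_of_right
          (u := fun x => A E * c E x + B E * s E x)
          (u' := fun x => A E * c' E x + B E * s' E x) hL.le hq (hκre E) h0 hb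
          (by rw [hκE]; exact (hF E).cos.linearCombination (hF E).sin (A E) (B E))
          (h1 E) (h2 E) hx
      exact ⟨hlim fun E h0 hb => (h E h0 hb).1, hlim fun E h0 hb => (h E h0 hb).2⟩
    have hdet₁ : ∀ E, c₁ E L * s₁' E L - c₁' E L * s₁ E L = 1 := fun E =>
      (hF₁ E).det_eq_one hL.le hLL
    have hAB : ∀ E, A E * c₁ E L + B E * s₁ E L = 1 := fun E => by
      simp only [hA, hB]; linear_combination hdet₁ E
    have hAB' : ∀ E, A E * c₁' E L + B E * s₁' E L = -κ E := fun E => by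
      simp only [hA, hB]; linear_combination (-κ E) * hdet₁ E
    obtain ⟨hG₁, -⟩ := growing hq₁ hF₁
    obtain ⟨hG₂, hG₂'⟩ := growing hq₂ hF₂
    obtain ⟨hD₁, -⟩ := decaying hq₁ hF₁ hAB hAB'
    -- Equality of the transfer matrices at L enters here: the same A and B give data (1, -κ) at L
    -- for q₂ as well.
    obtain ⟨hD₂, hD₂'⟩ := decaying hq₂ hF₂
      (fun E => by rw [← hAB E]; simp only [hc₁, hs₁, hc₂, hs₂, hc E, hs E])
      (fun E => by rw [← hAB' E]; simp only [hc₁', hs₁', hc₂', hs₂', hc' E, hs' E])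
    set G₁ := fun E => e E * (c₁ E x + κ E * s₁ E x)
    set G₂ := fun E => e E * (c₂ E x + κ E * s₂ E x)
    set G₂' := fun E => e E * ((c₂' E x + κ E * s₂' E x) / κ E)
    set D₁ := fun E => d E * (A E * c₁ E x + B E * s₁ E x)
    set D₂ := fun E => d E * (A E * c₂ E x + B E * s₂ E x)
    set D₂' := fun E => d E * ((A E * c₂' E x + B E * s₂' E x) / κ E)
    have hdet₂ : ∀ E, c₂ E x * s₂' E x - c₂' E x * s₂ E x = 1 := fun E =>
      (hF₂ E).det_eq_one hL.le hx
    have hrel : ∀ E, κ E ≠ 0 → N₁ E * G₂ E + κ E * N₂ E * G₂' E = G₁ E ∧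
        N₁ E * D₂ E + κ E * N₂ E * D₂' E = D₁ E := by
      intro E h0
      have h1 : N₁ E * c₂ E x + N₂ E * c₂' E x = c₁ E x := by
        simp only [hN₁, hN₂]; linear_combination c₁ E x * hdet₂ E
      have h2 : N₁ E * s₂ E x + N₂ E * s₂' E x = s₁ E x := by
        simp only [hN₁, hN₂]; linear_combination s₁ E x * hdet₂ E
      have h3 : ∀ z : ℂ, κ E * (z / κ E) = z := fun z => by field_simp
      constructor
      · simp only [G₁, G₂, G₂']
        linear_combination N₂ E * e E * h3 (c₂' E x + κ E * s₂' E x) + e E * h1 +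
          e E * κ E * h2
      · simp only [D₁, D₂, D₂']
        linear_combination N₂ E * d E * h3 (A E * c₂' E x + B E * s₂' E x) + d E * A E * h1 +
          d E * B E * h2
    -- The relations form a linear system for N₁ and κN₂. Its determinant tends to -2, so Cramer's
    -- rule gives the limits; the exponential factors are already absorbed in the G and D.
    have hΔ : Tendsto (fun E => G₂ E * D₂' E - G₂' E * D₂ E) (cocompact ℂ) (𝓝 (-2)) := by
      have := (hG₂.mul hD₂').sub (hG₂'.mul hD₂)
      norm_num at this
      exact this
    have hΔ0 : ∀ᶠ E in cocompact ℂ, G₂ E * D₂' E - G₂' E * D₂ E ≠ 0 :=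
      hΔ.eventually_ne (by norm_num)
    have hκ0 : ∀ᶠ E in cocompact ℂ, κ E ≠ 0 := by
      filter_upwards [hκtop.eventually_gt_atTop 0] with E h using norm_pos_iff.1 h
    have hN₁lim : Tendsto N₁ (cocompact ℂ) (𝓝 1) := by
      have h := ((hG₁.mul hD₂').sub (hG₂'.mul hD₁)).div hΔ (by norm_num)
      norm_num at h
      refine h.congr' ?_
      filter_upwards [hΔ0, hκ0] with E h1 h2
      obtain ⟨h3, h4⟩ := hrel E h2
      simp only [Pi.div_apply]
      rw [div_eq_iff h1]
      linear_combination (-D₂' E) * h3 + G₂' E * h4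
    have hN₂lim : Tendsto N₂ (cocompact ℂ) (𝓝 0) := by
      have h := ((hG₂.mul hD₁).sub (hD₂.mul hG₁)).div hΔ (by norm_num)
      have hinv : Tendsto (fun E => (κ E)⁻¹) (cocompact ℂ) (𝓝 0) := by
        rw [tendsto_zero_iff_norm_tendsto_zero]
        simp only [norm_inv]
        exact hκtop.inv_tendsto_atTop
      have h' := h.mul hinv
      norm_num at h'
      refine h'.congr' ?_
      filter_upwards [hΔ0, hκ0] with E h1 h2
      obtain ⟨h3, h4⟩ := hrel E h2
      rw [div_mul_eq_mul_div, div_eq_iff h1, mul_inv_eq_iff_eq_mul₀ h2]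
      linear_combination (-G₂ E) * h4 + D₂ E * h3
    have hdiff := fun a b => differentiable_IccExtend hL.le
      (differentiable_solution hL.le hq₁ a b) x
    have hdiff₂ := fun a b => differentiable_IccExtend hL.le
      (differentiable_solution hL.le hq₂ a b) x
    have hdiff₂' := fun a b => differentiable_IccExtend hL.le
      (differentiable_solutionDeriv hL.le hq₂ a b) x
    have hd₁ : Differentiable ℂ N₁ :=
      ((hdiff 1 0).mul (hdiff₂' 0 1)).sub ((hdiff 0 1).mul (hdiff₂' 1 0))
    have hd₂ : Differentiable ℂ N₂ :=
      ((hdiff 0 1).mul (hdiff₂ 1 0)).sub ((hdiff 1 0).mul (hdiff₂ 0 1))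
    -- Liouville: an entire function with a limit at infinity equals that limit.
    exact fun E => ⟨hd₁.apply_eq_of_tendsto_cocompact E hN₁lim,
      hd₂.apply_eq_of_tendsto_cocompact E hN₂lim⟩
  refine (hF₁ 0).potential_ae_eq hL (hF₂ 0) (fun x hx => ?_) (fun x hx => ?_)
  · obtain ⟨h1, h2⟩ := hN x hx 0
    have h3 := (hF₂ 0).det_eq_one hL.le hx
    linear_combination (-c₁ 0 x) * h3 + c₂ 0 x * h1 + c₂' 0 x * h2
  · obtain ⟨h1, h2⟩ := hN x hx 0
    have h3 := (hF₂ 0).det_eq_one hL.le hx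
    linear_combination (-s₁ 0 x) * h3 + s₂ 0 x * h1 + s₂' 0 x * h2

end InverseProblem

/-! ### A type-F criterion in SL(2, ℝ) -/

section TypeF

/-- The adjugate of a nonzero 2×2 matrix is nonzero, and M · adj M = 0 bounds the sum of their ranks
by 2. -/
theorem rank_eq_one_of_det_eq_zero {M : Matrix (Fin 2) (Fin 2) ℝ} (h0 : M ≠ 0)
    (hd : M.det = 0) : M.rank = 1 := by
  have hpos : ∀ N : Matrix (Fin 2) (Fin 2) ℝ, N ≠ 0 → 1 ≤ N.rank := by
    intro N hN
    by_contra h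
    have h1 : N.rank = 0 := by omega
    rw [Matrix.rank, Submodule.finrank_eq_zero, LinearMap.range_eq_bot] at h1
    refine hN (Matrix.ext_of_mulVec_single fun i => ?_)
    have h2 : N.mulVec (Pi.single i 1) = 0 :=
      congrArg (fun f : (Fin 2 → ℝ) →ₗ[ℝ] (Fin 2 → ℝ) => f (Pi.single i 1)) h1
    rw [h2, Matrix.zero_mulVec]
  have hadj : M.adjugate ≠ 0 := fun h => h0 <| by
    rw [Matrix.adjugate_fin_two] at h
    ext i j
    have h00 := congrFun (congrFun h 0) 0
    have h01 := congrFun (congrFun h 0) 1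
    have h10 := congrFun (congrFun h 1) 0
    have h11 := congrFun (congrFun h 1) 1
    fin_cases i <;> fin_cases j <;> simp_all
  have h := Matrix.rank_add_rank_le_card_of_mul_eq_zero (A := M) (B := M.adjugate)
    (by rw [Matrix.mul_adjugate, hd, zero_smul])
  have h1 := hpos M h0
  have h2 := hpos _ hadj
  simp only [Fintype.card_fin] at h
  omega

/-- An unbounded sequence in `G` yields a contracting one. -/
theorem isContracting_of_tendsto_norm {G : Subgroup SL(2, ℝ)} {g : ℕ → SL(2, ℝ)}
    (hg : ∀ n, g n ∈ G)
    (hlim : Tendsto (fun n => ‖Matrix.toEuclideanCLM (𝕜 := ℝ)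
      (g n : Matrix (Fin 2) (Fin 2) ℝ)‖) atTop atTop) : IsContracting G := by
  set φ := Matrix.toEuclideanCLM (𝕜 := ℝ) (n := Fin 2) with hφ
  have hcont : Continuous φ.symm := by
    have h : Continuous (φ.symm.toAlgEquiv.toLinearEquiv.toLinearMap) :=
      LinearMap.continuous_of_finiteDimensional _
    exact h
  obtain ⟨X, hX, θ, hθ, hXlim⟩ := (isCompact_closedBall (0 : EuclideanSpace ℝ (Fin 2) →L[ℝ]
    EuclideanSpace ℝ (Fin 2)) 1).tendsto_subseq
    (x := fun n => ‖φ (g n : Matrix (Fin 2) (Fin 2) ℝ)‖⁻¹ • φ (g n : Matrix (Fin 2) (Fin 2) ℝ))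
    (fun n => by
      rw [mem_closedBall_zero_iff, norm_smul, norm_inv, norm_norm]
      exact inv_mul_le_one)
  have hlim' := hlim.comp hθ.tendsto_atTop
  have hnorm : ‖X‖ = 1 := by
    refine tendsto_nhds_unique hXlim.norm (tendsto_const_nhds.congr' ?_)
    filter_upwards [hlim'.eventually_gt_atTop 0] with n hn
    simp only [Function.comp_apply] at hn ⊢
    rw [norm_smul, norm_inv, norm_norm, inv_mul_cancel₀ hn.ne']
  have hL : Tendsto (fun n => ‖φ (g (θ n) : Matrix (Fin 2) (Fin 2) ℝ)‖⁻¹ •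
      (g (θ n) : Matrix (Fin 2) (Fin 2) ℝ)) atTop (𝓝 (φ.symm X)) := by
    refine ((hcont.tendsto X).comp hXlim).congr fun n => ?_
    rw [Function.comp_apply, Function.comp_apply, ← map_smul, StarAlgEquiv.symm_apply_apply]
  refine ⟨fun n => g (θ n), fun n => hg _, φ.symm X, rank_eq_one_of_det_eq_zero ?_ ?_, hL⟩
  · intro h
    have h1 : X = 0 := by rw [← StarAlgEquiv.apply_symm_apply φ X, h, map_zero]
    simp [h1] at hnorm
  -- The normalised matrices have determinant ‖gₙ‖⁻², which tends to 0.
  · refine tendsto_nhds_unique ((Continuous.matrix_det continuous_id).continuousAt.tendsto.comp hL)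
      ?_
    have h1 : Tendsto (fun n => (‖φ (g (θ n) : Matrix (Fin 2) (Fin 2) ℝ)‖⁻¹) ^ 2) atTop (𝓝 0) := by
      simpa using (hlim'.inv_tendsto_atTop).pow 2
    refine h1.congr fun n => ?_
    simp

theorem trace_sq_of_det_eq_one {M : Matrix (Fin 2) (Fin 2) ℝ} (h : M.det = 1) :
    (M * M).trace = M.trace ^ 2 - 2 := by
  rw [Matrix.det_fin_two] at h
  simp only [Matrix.trace_fin_two, Matrix.mul_apply, Fin.sum_univ_two]
  linear_combination (-2) * h

/-- Squaring sends the trace t to t² - 2, so along repeated squares |t| - 2 grows at least linearly.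
The trace is a bounded functional, so the norms are unbounded too. -/
theorem isContracting_of_two_lt_abs_trace {G : Subgroup SL(2, ℝ)} {h : SL(2, ℝ)} (hG : h ∈ G)
    (htr : 2 < |(h : Matrix (Fin 2) (Fin 2) ℝ).trace|) : IsContracting G := by
  set ε := |(h : Matrix (Fin 2) (Fin 2) ℝ).trace| - 2 with hε
  have hε0 : 0 < ε := by linarith
  have hgrow : ∀ n : ℕ, 2 + (n + 1) * ε ≤
      |((h ^ 2 ^ n : SL(2, ℝ)) : Matrix (Fin 2) (Fin 2) ℝ).trace| := by
    intro n
    induction n with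
    | zero => simp [hε]
    | succ n ih =>
      rw [pow_succ, pow_mul, sq, Matrix.SpecialLinearGroup.coe_mul,
        trace_sq_of_det_eq_one (Matrix.SpecialLinearGroup.det_coe _)]
      set t := ((h ^ 2 ^ n : SL(2, ℝ)) : Matrix (Fin 2) (Fin 2) ℝ).trace
      refine le_trans ?_ (le_abs_self _)
      rw [← sq_abs]
      have hn : (0 : ℝ) ≤ n := n.cast_nonneg
      push_cast
      nlinarith [mul_nonneg hn hε0.le]
  set φ := Matrix.toEuclideanCLM (𝕜 := ℝ) (n := Fin 2) with hφ
  set τ : (EuclideanSpace ℝ (Fin 2) →L[ℝ] EuclideanSpace ℝ (Fin 2)) →L[ℝ] ℝ :=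
    LinearMap.toContinuousLinearMap ((Matrix.traceLinearMap (Fin 2) ℝ ℝ).comp
      φ.symm.toAlgEquiv.toLinearEquiv.toLinearMap) with hτ
  have hτle : ∀ M : Matrix (Fin 2) (Fin 2) ℝ, |M.trace| ≤ ‖τ‖ * ‖φ M‖ := by
    intro M
    have h1 : τ (φ M) = M.trace := congrArg Matrix.trace (StarAlgEquiv.symm_apply_apply φ M)
    rw [← h1, ← Real.norm_eq_abs]
    exact τ.le_opNorm _
  have hτ0 : 0 < ‖τ‖ := by
    refine (norm_nonneg τ).lt_of_ne fun h0 => ?_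
    have := hτle h
    rw [← h0, zero_mul] at this
    linarith
  refine isContracting_of_tendsto_norm (g := fun n => h ^ 2 ^ n)
    (fun n => G.pow_mem hG _) ?_
  have hbig : Tendsto (fun n : ℕ => ε / ‖τ‖ * (n : ℝ)) atTop atTop :=
    tendsto_natCast_atTop_atTop.const_mul_atTop (div_pos hε0 hτ0)
  refine tendsto_atTop_mono (fun n => ?_) hbig
  rw [div_mul_eq_mul_div, div_le_iff₀ hτ0]
  have h1 := (hgrow n).trans (hτle _)
  linarith

/-- The commutator `AB - BA` with an elliptic matrix `A` has nonpositive determinant, with equality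
only if the matrices commute. -/
theorem det_commutator_of_elliptic {A B : Matrix (Fin 2) (Fin 2) ℝ} (hA : A.det = 1)
    (hell : A.trace ^ 2 < 4) :
    (A * B - B * A).det ≤ 0 ∧ ((A * B - B * A).det = 0 → A * B = B * A) := by
  set C := A * B - B * A with hC
  have htr : C 1 1 = - C 0 0 := by
    simp only [hC, Matrix.sub_apply, Matrix.mul_apply, Fin.sum_univ_two]; ring
  -- This is tr(AC) = 0. On traceless matrices -det is a form of signature (2, 1). The traceless
  -- part of the elliptic A is negative for it, so the form is positive definite on the orthogonal
  -- complement, where C lies.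
  have horth : (A 0 0 - A 1 1) * C 0 0 + A 0 1 * C 1 0 + A 1 0 * C 0 1 = 0 := by
    simp only [hC, Matrix.sub_apply, Matrix.mul_apply, Fin.sum_univ_two]; ring
  have hdisc : (A 0 0 - A 1 1) ^ 2 + 4 * (A 0 1 * A 1 0) < 0 := by
    rw [Matrix.det_fin_two] at hA
    rw [Matrix.trace_fin_two] at hell
    nlinarith
  have hdet : C.det = -(C 0 0 ^ 2 + C 0 1 * C 1 0) := by
    rw [Matrix.det_fin_two, htr]; ring
  have hb : A 0 1 ≠ 0 := by
    intro h0
    rw [h0] at hdisc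
    nlinarith [sq_nonneg (A 0 0 - A 1 1)]
  have hb2 : 0 < A 0 1 ^ 2 := by positivity
  have key : 4 * A 0 1 ^ 2 * (C 0 0 ^ 2 + C 0 1 * C 1 0) =
      (2 * A 0 1 * C 0 0 - (A 0 0 - A 1 1) * C 0 1) ^ 2 +
        -((A 0 0 - A 1 1) ^ 2 + 4 * (A 0 1 * A 1 0)) * C 0 1 ^ 2 := by
    linear_combination (4 * A 0 1 * C 0 1) * horth
  have h1 : 0 ≤ (2 * A 0 1 * C 0 0 - (A 0 0 - A 1 1) * C 0 1) ^ 2 := sq_nonneg _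
  have h2 : 0 ≤ -((A 0 0 - A 1 1) ^ 2 + 4 * (A 0 1 * A 1 0)) * C 0 1 ^ 2 :=
    mul_nonneg (by linarith) (sq_nonneg _)
  constructor
  · rw [hdet, neg_nonpos]
    by_contra h
    push Not at h
    nlinarith
  · intro h0
    rw [hdet, neg_eq_zero] at h0
    rw [h0, mul_zero] at key
    have h3 : -((A 0 0 - A 1 1) ^ 2 + 4 * (A 0 1 * A 1 0)) * C 0 1 ^ 2 = 0 := by linarith
    have h01 : C 0 1 = 0 := by
      rcases mul_eq_zero.1 h3 with h | h
      · linarith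
      · exact pow_eq_zero_iff two_ne_zero |>.1 h
    rw [h01] at key
    have h00 : C 0 0 = 0 := by
      rw [h01] at h0
      nlinarith
    have h10 : C 1 0 = 0 := by
      rw [h01, h00] at horth
      simpa [hb] using horth
    have hC0 : C = 0 := by
      ext i j
      fin_cases i <;> fin_cases j <;> simp [h00, h01, h10, htr]
    exact sub_eq_zero.1 hC0

/-- With K = ABA⁻¹B⁻¹ one has AB - BA = (K - 1)BA, and det(K - 1) = 2 - tr K when det K = 1. -/
theorem trace_commutator {A B : SL(2, ℝ)} :
    ((A * B * A⁻¹ * B⁻¹ : SL(2, ℝ)) : Matrix (Fin 2) (Fin 2) ℝ).trace =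
      2 - ((A : Matrix (Fin 2) (Fin 2) ℝ) * B - B * A).det := by
  have hA := A.det_coe
  have hB := B.det_coe
  rw [Matrix.det_fin_two] at hA hB
  simp only [Matrix.SpecialLinearGroup.coe_mul, Matrix.SpecialLinearGroup.coe_inv,
    Matrix.adjugate_fin_two, Matrix.det_fin_two, Matrix.trace_fin_two, Matrix.sub_apply,
    Matrix.mul_apply, Fin.sum_univ_two, Matrix.of_apply, Matrix.cons_val', Matrix.cons_val_zero,
    Matrix.cons_val_one, Matrix.cons_val_fin_one]
  set a := (A : Matrix (Fin 2) (Fin 2) ℝ) 0 0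
  set b := (A : Matrix (Fin 2) (Fin 2) ℝ) 0 1
  set c := (A : Matrix (Fin 2) (Fin 2) ℝ) 1 0
  set d := (A : Matrix (Fin 2) (Fin 2) ℝ) 1 1
  set e := (B : Matrix (Fin 2) (Fin 2) ℝ) 0 0
  set f := (B : Matrix (Fin 2) (Fin 2) ℝ) 0 1
  set g := (B : Matrix (Fin 2) (Fin 2) ℝ) 1 0
  set h := (B : Matrix (Fin 2) (Fin 2) ℝ) 1 1
  linear_combination 2 * hA * (e * h - f * g) + 2 * hB

theorem exists_eigenvector_of_smul_eq {A : SL(2, ℝ)} {v : Fin 2 → ℝ} (hv : v ≠ 0)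
    (h : A • Projectivization.mk ℝ v hv = Projectivization.mk ℝ v hv) :
    ∃ a : ℝ, (A : Matrix (Fin 2) (Fin 2) ℝ).mulVec v = a • v := by
  rw [Projectivization.smul_mk, Projectivization.mk_eq_mk_iff'] at h
  obtain ⟨a, ha⟩ := h
  exact ⟨a, ha.symm⟩

/-- A common eigenvector lies in the kernel of AB - BA. -/
theorem det_commutator_eq_zero_of_smul_eq {A B : SL(2, ℝ)} {p : ℙ ℝ (Fin 2 → ℝ)}
    (hA : A • p = p) (hB : B • p = p) :
    ((A : Matrix (Fin 2) (Fin 2) ℝ) * B - B * A).det = 0 := by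
  induction p using Projectivization.ind with
  | h v hv =>
    obtain ⟨a, ha⟩ := exists_eigenvector_of_smul_eq hv hA
    obtain ⟨b, hb⟩ := exists_eigenvector_of_smul_eq hv hB
    refine Matrix.exists_mulVec_eq_zero_iff.1 ⟨v, hv, ?_⟩
    rw [Matrix.sub_mulVec, ← Matrix.mulVec_mulVec, ← Matrix.mulVec_mulVec, ha, hb,
      Matrix.mulVec_smul, Matrix.mulVec_smul, ha, hb, smul_comm, sub_self]

/-- By Cayley–Hamilton A² = (tr A)A - 1, so an eigenvector of A² is one of A when tr A ≠ 0. Hence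
only elements of trace zero can swap two lines. -/
theorem smul_eq_of_smul_smul_eq {A : SL(2, ℝ)} {p : ℙ ℝ (Fin 2 → ℝ)}
    (htr : (A : Matrix (Fin 2) (Fin 2) ℝ).trace ≠ 0) (hA : A • A • p = p) : A • p = p := by
  induction p using Projectivization.ind with
  | h v hv =>
    rw [← mul_smul] at hA
    obtain ⟨a, ha⟩ := exists_eigenvector_of_smul_eq hv hA
    rw [Projectivization.smul_mk, Projectivization.mk_eq_mk_iff']
    refine ⟨(a + 1) / (A : Matrix (Fin 2) (Fin 2) ℝ).trace, ?_⟩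
    have hdet := A.det_coe
    rw [Matrix.det_fin_two] at hdet
    change _ = (A : Matrix (Fin 2) (Fin 2) ℝ).mulVec v
    ext i
    have hi := congrFun ha i
    rw [Pi.smul_apply, smul_eq_mul, div_mul_eq_mul_div, div_eq_iff htr]
    revert hi
    rw [Matrix.trace_fin_two]
    fin_cases i <;>
    · simp [Matrix.mulVec, dotProduct, Fin.sum_univ_two, Matrix.mul_apply]
      intro hi
      linear_combination -hi - v _ * hdet

/-- A criterion for a subgroup of `SL(2, ℝ)` to be of type F. -/
theorem isTypeF_of_mem {G : Subgroup SL(2, ℝ)} {A B : SL(2, ℝ)} (hA : A ∈ G) (hB : B ∈ G)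
    (hA0 : (A : Matrix (Fin 2) (Fin 2) ℝ).trace ≠ 0)
    (hA4 : (A : Matrix (Fin 2) (Fin 2) ℝ).trace ^ 2 ≠ 4)
    (hB0 : (B : Matrix (Fin 2) (Fin 2) ℝ).trace ≠ 0)
    (hAB : ((A : Matrix (Fin 2) (Fin 2) ℝ) * B - B * A).det ≠ 0) : IsTypeF G := by
  constructor
  · rcases lt_or_gt_of_ne hA4 with h | h
    · have hdet := lt_of_le_of_ne (det_commutator_of_elliptic (B := B) A.det_coe h).1 hAB
      refine isContracting_of_two_lt_abs_trace
        (G.mul_mem (G.mul_mem (G.mul_mem hA hB) (G.inv_mem hA)) (G.inv_mem hB)) ?_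
      rw [trace_commutator]
      exact lt_of_lt_of_le (by linarith) (le_abs_self _)
    · refine isContracting_of_two_lt_abs_trace hA ?_
      rw [← sq_abs] at h
      nlinarith [abs_nonneg (A : Matrix (Fin 2) (Fin 2) ℝ).trace]
  · rintro ⟨Λ, hcard, hinv⟩
    have hex : ∃ p : ℙ ℝ (Fin 2 → ℝ), ∀ g ∈ G,
        (g : Matrix (Fin 2) (Fin 2) ℝ).trace ≠ 0 → g • p = p := by
      rcases hcard with h1 | h2
      · obtain ⟨p, rfl⟩ := Set.ncard_eq_one.1 h1
        refine ⟨p, fun g hg _ => ?_⟩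
        simpa using hinv g hg
      · obtain ⟨p, r, hpr, rfl⟩ := Set.ncard_eq_two.1 h2
        refine ⟨p, fun g hg hg0 => smul_eq_of_smul_smul_eq hg0 ?_⟩
        have h := hinv g hg
        have hp : g • p ∈ ({p, r} : Set (ℙ ℝ (Fin 2 → ℝ))) := by
          rw [← h]; exact Set.smul_mem_smul_set (by simp)
        have hr : g • r ∈ ({p, r} : Set (ℙ ℝ (Fin 2 → ℝ))) := by
          rw [← h]; exact Set.smul_mem_smul_set (by simp)
        rcases hp with hp | hp
        · rw [hp, hp]
        · rw [Set.mem_singleton_iff] at hp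
          rcases hr with hr | hr
          · rw [hp, hr]
          · rw [Set.mem_singleton_iff] at hr
            exact absurd (smul_left_cancel g (hp.trans hr.symm)) hpr
    obtain ⟨p, hp⟩ := hex
    exact hAB (det_commutator_eq_zero_of_smul_eq (hp A hA hA0) (hp B hB hB0))

end TypeF

/-! ### Fundamental matrices of pieces -/

section TransferMatrix

variable {δ m : ℝ}

theorem Piece.len_pos (hδ : 0 < δ) (w : Piece δ m) : 0 < w.len :=
  hδ.trans_le w.len_mem.1

theorem Piece.intervalIntegrable_ext (w : Piece δ m) (a b : ℝ) :
    IntervalIntegrable (fun t => (w.ext t : ℂ)) volume a b := by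
  have h : IntervalIntegrable w.ext volume a b := by
    rw [intervalIntegrable_iff]
    have : IsFiniteMeasure (volume.restrict (uIoc a b)) :=
      ⟨by rw [Measure.restrict_apply_univ]; exact measure_Ioc_lt_top⟩
    exact ((Lp.memLp w.ext).restrict _).integrable (by norm_num)
  exact ⟨h.1.ofReal, h.2.ofReal⟩

theorem Piece.ae_ext_eq_pot (w : Piece δ m) : ∀ᵐ x, x ∈ Ioc 0 w.len → w.ext x = w.pot x := by
  have hne : ∀ᵐ x : ℝ, x ≠ w.len := by simp [ae_iff, measure_singleton]
  filter_upwards [w.coeFn_ext, hne] with x hx hx' hxw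
  have hmem : x ∈ Ico 0 w.len := ⟨hxw.1.le, lt_of_le_of_ne hxw.2 hx'⟩
  rw [hx, indicator_of_mem hmem]

theorem Piece.intervalIntegrable_pot (w : Piece δ m) (hw : 0 ≤ w.len) :
    IntervalIntegrable (fun t => (w.pot t : ℂ)) volume 0 w.len := by
  refine (w.intervalIntegrable_ext 0 w.len).congr_ae ?_
  rw [uIoc_of_le hw]
  refine (ae_restrict_iff' measurableSet_Ioc).2 ?_
  filter_upwards [w.ae_ext_eq_pot] with x hx hxw using by rw [hx hxw]

/-- The fundamental matrix, at the end point of the piece and at a complex energy. -/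
noncomputable def Piece.fundamentalMatrix (w : Piece δ m) (hm : 0 ≤ m) (E : ℂ) :
    Matrix (Fin 2) (Fin 2) ℂ :=
  !![IccExtend hm (solution hm (w.intervalIntegrable_ext 0 m) E 1 0) w.len,
      IccExtend hm (solution hm (w.intervalIntegrable_ext 0 m) E 0 1) w.len;
    IccExtend hm (solutionDeriv hm (w.intervalIntegrable_ext 0 m) E 1 0) w.len,
      IccExtend hm (solutionDeriv hm (w.intervalIntegrable_ext 0 m) E 0 1) w.len]

/-- All pieces are solved on the common interval [0, m] after extension by zero, so that solutions
for different lengths live in one Banach space. On the domain of the piece nothing changes. -/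
theorem Piece.isSchrodinger_solution (hδ : 0 < δ) (w : Piece δ m) (hm : 0 ≤ m) (E a b : ℂ) :
    IsSchrodinger w.len (fun t => (w.pot t : ℂ)) E
      (IccExtend hm (solution hm (w.intervalIntegrable_ext 0 m) E a b))
      (IccExtend hm (solutionDeriv hm (w.intervalIntegrable_ext 0 m) E a b)) := by
  refine ((ContinuumAnderson.isSchrodinger_solution hm (w.intervalIntegrable_ext 0 m) E a
    b).mono_mem
    ⟨(w.len_pos hδ).le, w.len_mem.2⟩).congr_potential (w.len_pos hδ).le ?_
  filter_upwards [w.ae_ext_eq_pot] with x hx hxw using by rw [hx hxw]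

theorem Piece.isFundamental (hδ : 0 < δ) (w : Piece δ m) (hm : 0 ≤ m) (E : ℂ) :
    IsFundamental w.len (fun t => (w.pot t : ℂ)) E
      (IccExtend hm (solution hm (w.intervalIntegrable_ext 0 m) E 1 0))
      (IccExtend hm (solutionDeriv hm (w.intervalIntegrable_ext 0 m) E 1 0))
      (IccExtend hm (solution hm (w.intervalIntegrable_ext 0 m) E 0 1))
      (IccExtend hm (solutionDeriv hm (w.intervalIntegrable_ext 0 m) E 0 1)) :=
  ⟨w.isSchrodinger_solution hδ hm E 1 0, w.isSchrodinger_solution hδ hm E 0 1,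
    solution_zero _ _ _ _ _, solutionDeriv_zero _ _ _ _ _, solution_zero _ _ _ _ _,
    solutionDeriv_zero _ _ _ _ _⟩

theorem Piece.fundamentalMatrix_mulVec (hδ : 0 < δ) (w : Piece δ m) (hm : 0 ≤ m) {E : ℂ}
    {u u' : ℝ → ℂ} (hu : IsSchrodinger w.len (fun t => (w.pot t : ℂ)) E u u') :
    (w.fundamentalMatrix hm E).mulVec ![u 0, u' 0] = ![u w.len, u' w.len] := by
  have h := w.isFundamental hδ hm E
  have hw : w.len ∈ Icc 0 w.len := ⟨(w.len_pos hδ).le, le_rfl⟩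
  rw [h.eq_combination (w.len_pos hδ).le hu hw, h.deriv_eq_combination (w.len_pos hδ).le hu hw]
  ext i
  fin_cases i <;>
  · simp [fundamentalMatrix, Matrix.mulVec, dotProduct, Fin.sum_univ_two]
    ring

theorem Piece.det_fundamentalMatrix (hδ : 0 < δ) (w : Piece δ m) (hm : 0 ≤ m) (E : ℂ) :
    (w.fundamentalMatrix hm E).det = 1 := by
  have h := (w.isFundamental hδ hm E).det_eq_one (w.len_pos hδ).le
    ⟨(w.len_pos hδ).le, le_rfl⟩
  rw [Matrix.det_fin_two]
  simp only [fundamentalMatrix, Matrix.of_apply, Matrix.cons_val', Matrix.cons_val_zero,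
    Matrix.cons_val_one, Matrix.cons_val_fin_one]
  linear_combination h

/-- A real solution is a complex solution. -/
theorem IsSolution.isSchrodinger (hδ : 0 < δ) {w : Piece δ m} {E : ℝ} {ψ ψ' : ℝ → ℝ}
    (h : IsSolution E w ψ ψ') : IsSchrodinger w.len (fun t => (w.pot t : ℂ)) E
      (fun x => (ψ x : ℂ)) (fun x => (ψ' x : ℂ)) := by
  have hw := (w.len_pos hδ).le
  have hcont : ContinuousOn ψ (Icc 0 w.len) := fun x hx =>
    (h.hasDeriv x hx).continuousWithinAt
  have h2 : HasIntegralDeriv w.len (fun x => (ψ' x : ℂ))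
      (fun t => ((w.pot t : ℂ) - E) * ψ t) := by
    refine ⟨((w.intervalIntegrable_pot hw).sub intervalIntegrable_const).mul_continuousOn ?_,
      fun x hx => ?_⟩
    · rw [uIcc_of_le hw]
      exact Complex.continuous_ofReal.comp_continuousOn hcont
    · rw [h.deriv_eq x hx]
      push_cast
      rw [← intervalIntegral.integral_ofReal]
      push_cast
      rfl
  refine ⟨⟨?_, fun x hx => ?_⟩, h2⟩
  · have := h2.continuousOn
    rw [← uIcc_of_le hw] at this
    exact this.intervalIntegrable
  · have hsub : Icc 0 x ⊆ Icc 0 w.len := Icc_subset_Icc_right hx.2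
    have hcont' : ContinuousOn (fun x => (ψ' x : ℂ)) (uIcc 0 x) := by
      rw [uIcc_of_le hx.1]
      exact h2.continuousOn.mono hsub
    rw [integral_eq_sub_of_hasDerivAt_of_le (f := fun x => (ψ x : ℂ)) hx.1
      (Complex.continuous_ofReal.comp_continuousOn (hcont.mono hsub)) (fun y hy => ?_)
      hcont'.intervalIntegrable]
    · ring
    · exact ((h.hasDeriv y (hsub (Ioo_subset_Icc_self hy))).hasDerivAt
        (Icc_mem_nhds hy.1 (hy.2.trans_le hx.2))).ofReal_comp

/-- The real part of a complex solution at a real energy is a real solution. -/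
theorem Piece.isSolution_re (hδ : 0 < δ) (w : Piece δ m) (hm : 0 ≤ m) (E : ℝ) (a b : ℂ) :
    IsSolution E w
      (fun x => (IccExtend hm (solution hm (w.intervalIntegrable_ext 0 m) E a b) x).re)
      (fun x => (IccExtend hm (solutionDeriv hm (w.intervalIntegrable_ext 0 m) E a b) x).re) := by
  have h := w.isSchrodinger_solution hδ hm E a b
  have hc := continuous_IccExtend_coe hm (solutionDeriv hm (w.intervalIntegrable_ext 0 m) E a b)
  set u := IccExtend hm (solution hm (w.intervalIntegrable_ext 0 m) E a b)
  set u' := IccExtend hm (solutionDeriv hm (w.intervalIntegrable_ext 0 m) E a b)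
  constructor
  · intro x hx
    have h1 : HasDerivAt (fun x => u 0 + ∫ t in (0 : ℝ)..x, u' t) (u' x) x :=
      (integral_hasDerivAt_right (hc.intervalIntegrable _ _)
        hc.aestronglyMeasurable.stronglyMeasurableAtFilter hc.continuousAt).const_add _
    have h2 : HasDerivWithinAt u (u' x) (Icc 0 w.len) x :=
      h1.hasDerivWithinAt.congr (fun y hy => h.deriv.eq_add y hy) (h.deriv.eq_add x hx)
    exact (Complex.reCLM.hasFDerivAt.comp_hasDerivWithinAt x h2)
  · intro x hx
    have h1 := congrArg Complex.re (h.deriv_deriv.eq_add x hx)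
    rw [Complex.add_re] at h1
    rw [h1]
    congr 1
    have h2 := Complex.reCLM.intervalIntegral_comp_comm (h.deriv_deriv.mono_mem hx).integrable
    rw [Complex.reCLM_apply] at h2
    rw [← h2]
    refine integral_congr fun t _ => ?_
    simp [← Complex.ofReal_sub]

/-- The real part of a solution with real data and energy solves the same problem, so uniqueness
identifies the two. -/
theorem Piece.ofReal_re_solution (hδ : 0 < δ) (w : Piece δ m) (hm : 0 ≤ m) (E a b : ℝ) :
    ![((IccExtend hm (solution hm (w.intervalIntegrable_ext 0 m) E a b) w.len).re : ℂ),
      ((IccExtend hm (solutionDeriv hm (w.intervalIntegrable_ext 0 m) E a b) w.len).re : ℂ)] =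
    ![IccExtend hm (solution hm (w.intervalIntegrable_ext 0 m) E a b) w.len,
      IccExtend hm (solutionDeriv hm (w.intervalIntegrable_ext 0 m) E a b) w.len] := by
  rw [← w.fundamentalMatrix_mulVec hδ hm ((w.isSolution_re hδ hm E a b).isSchrodinger hδ),
    ← w.fundamentalMatrix_mulVec hδ hm (w.isSchrodinger_solution hδ hm E a b)]
  simp only [solution_zero, solutionDeriv_zero, Complex.ofReal_re]

end TransferMatrix

/-! ### Continuity, analyticity and concatenation -/

section TransferMatrixProperties

variable {δ m : ℝ}

theorem Piece.ofReal_re_fundamentalMatrix (hδ : 0 < δ) (w : Piece δ m) (hm : 0 ≤ m) (E : ℝ)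
    (i j : Fin 2) : ((w.fundamentalMatrix hm E i j).re : ℂ) = w.fundamentalMatrix hm E i j := by
  have h1 := w.ofReal_re_solution hδ hm E 1 0
  have h2 := w.ofReal_re_solution hδ hm E 0 1
  rw [Complex.ofReal_one, Complex.ofReal_zero] at h1 h2
  have h10 := congrFun h1 0
  have h11 := congrFun h1 1
  have h20 := congrFun h2 0
  have h21 := congrFun h2 1
  simp only [Matrix.cons_val_zero, Matrix.cons_val_one] at h10 h11 h20 h21
  fin_cases i <;> fin_cases j
  exacts [h10, h20, h11, h21]

/-- The `epsilon` in the definition carries information only once a witness exists; the entrywise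
real part of the fundamental matrix is one. -/
theorem isTransferMatrix_transferMatrix (hδ : 0 < δ) (hm : 0 ≤ m) (E : ℝ) (w : Piece δ m) :
    IsTransferMatrix E w (transferMatrix E w) := by
  refine Classical.epsilon_spec (p := IsTransferMatrix E w) ?_
  have hmap : ((w.fundamentalMatrix hm E).map Complex.re).map Complex.ofRealHom =
      w.fundamentalMatrix hm E := by
    ext i j
    exact w.ofReal_re_fundamentalMatrix hδ hm E i j
  refine ⟨⟨(w.fundamentalMatrix hm E).map Complex.re, ?_⟩, fun ψ ψ' hψ => ?_⟩
  · have h := w.det_fundamentalMatrix hδ hm E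
    rw [← hmap, ← RingHom.mapMatrix_apply, ← RingHom.map_det] at h
    exact Complex.ofReal_injective (by simpa using h)
  · have h := w.fundamentalMatrix_mulVec hδ hm (hψ.isSchrodinger hδ)
    ext i
    have hi := congrArg Complex.re (congrFun h i)
    fin_cases i <;>
    · simp [Matrix.mulVec, dotProduct, Fin.sum_univ_two] at hi ⊢
      exact hi.symm

/-- At real energies the transfer matrix is the fundamental matrix. -/
theorem ofReal_transferMatrix (hδ : 0 < δ) (hm : 0 ≤ m) (E : ℝ) (w : Piece δ m) :
    (transferMatrix E w : Matrix (Fin 2) (Fin 2) ℝ).map Complex.ofRealHom =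
      w.fundamentalMatrix hm E := by
  have key : ∀ a b : ℝ,
      ![((transferMatrix E w 0 0 * a + transferMatrix E w 0 1 * b : ℝ) : ℂ),
        ((transferMatrix E w 1 0 * a + transferMatrix E w 1 1 * b : ℝ) : ℂ)] =
      ![IccExtend hm (solution hm (w.intervalIntegrable_ext 0 m) E a b) w.len,
        IccExtend hm (solutionDeriv hm (w.intervalIntegrable_ext 0 m) E a b) w.len] := by
    intro a b
    have h1 := isTransferMatrix_transferMatrix hδ hm E w _ _ (w.isSolution_re hδ hm E a b)
    simp only [solution_zero, solutionDeriv_zero, Complex.ofReal_re] at h1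
    rw [← w.ofReal_re_solution hδ hm E a b]
    have h10 := congrFun h1 0
    have h11 := congrFun h1 1
    simp only [Matrix.cons_val_zero, Matrix.cons_val_one, Matrix.mulVec, dotProduct,
      Fin.sum_univ_two] at h10 h11
    rw [h10, h11]
  have h1 := key 1 0
  have h2 := key 0 1
  simp only [mul_one, mul_zero, add_zero, zero_add, Complex.ofReal_one, Complex.ofReal_zero]
    at h1 h2
  ext i j
  fin_cases i <;> fin_cases j
  exacts [congrFun h1 0, congrFun h2 0, congrFun h1 1, congrFun h2 1]

/-- Hölder on [0, m]: passes from the L² topology of pieces to the L¹ distance that controls the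
Volterra operators. -/
theorem norm_integral_ext_sub_le (hm : 0 ≤ m) (w₁ w₂ : Piece δ m) :
    ∫ t in (0 : ℝ)..m, ‖(w₁.ext t : ℂ) - w₂.ext t‖ ≤
      ‖w₁.ext - w₂.ext‖ * (volume (Ioc 0 m) ^ (1 / 2 : ℝ)).toReal := by
  set f := w₁.ext - w₂.ext with hf
  have hfm := Lp.memLp f
  have h1 : ∫ t in (0 : ℝ)..m, ‖(w₁.ext t : ℂ) - w₂.ext t‖ =
      (eLpNorm f 1 (volume.restrict (Ioc 0 m))).toReal := by
    rw [integral_of_le hm, eLpNorm_one_eq_lintegral_enorm,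
      ← integral_norm_eq_lintegral_enorm hfm.aestronglyMeasurable.restrict]
    refine integral_congr_ae ?_
    filter_upwards [ae_restrict_of_ae (Lp.coeFn_sub w₁.ext w₂.ext)] with t ht
    rw [hf, ht, Pi.sub_apply, ← Complex.ofReal_sub, Complex.norm_real]
  rw [h1, Lp.norm_def, ← ENNReal.toReal_mul]
  have hv : volume (Ioc 0 m) ≠ ⊤ := measure_Ioc_lt_top.ne
  refine ENNReal.toReal_mono (ENNReal.mul_ne_top hfm.2.ne
    (ENNReal.rpow_ne_top_of_nonneg (by norm_num) hv)) ?_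
  refine (eLpNorm_le_eLpNorm_mul_rpow_measure_univ (p := 1) (q := 2) (by norm_num)
    hfm.aestronglyMeasurable.restrict).trans ?_
  rw [Measure.restrict_apply_univ]
  refine mul_le_mul' (eLpNorm_mono_measure _ Measure.restrict_le_self) (le_of_eq ?_)
  norm_num

theorem continuous_piece : Continuous fun w : Piece δ m => (w.len, w.ext) :=
  continuous_induced_dom

/-- The function and the evaluation point both vary with the piece; uniform convergence to a
continuous limit allows this. -/
theorem continuous_IccExtend_len (hm : 0 ≤ m) {f : Piece δ m → (Icc 0 m →ᵇ ℂ)}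
    (hf : Continuous f) : Continuous fun w => IccExtend hm (f w) w.len := by
  refine continuous_iff_continuousAt.2 fun w₀ => ?_
  have h1 := BoundedContinuousFunction.tendsto_iff_tendstoUniformly.1 (hf.tendsto w₀)
  exact h1.tendsto_comp (f w₀).continuous.continuousAt
    ((continuous_projIcc.comp (continuous_fst.comp continuous_piece)).tendsto w₀)

theorem tendsto_integral_ext (hm : 0 ≤ m) (w₀ : Piece δ m) :
    Tendsto (fun w : Piece δ m => ∫ t in (0 : ℝ)..m, ‖(w.ext t : ℂ) - w₀.ext t‖) (𝓝 w₀)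
      (𝓝 0) := by
  have h1 : Tendsto (fun w : Piece δ m => w.ext) (𝓝 w₀) (𝓝 w₀.ext) :=
    (continuous_snd.comp continuous_piece).tendsto w₀
  rw [tendsto_iff_norm_sub_tendsto_zero] at h1
  have h2 := h1.mul_const (volume (Ioc 0 m) ^ (1 / 2 : ℝ)).toReal
  rw [zero_mul] at h2
  exact squeeze_zero (fun w => integral_nonneg hm fun _ _ => norm_nonneg _)
    (fun w => norm_integral_ext_sub_le hm w w₀) h2

theorem continuous_fundamentalMatrix (hm : 0 ≤ m) (E : ℂ) :
    Continuous fun w : Piece δ m => w.fundamentalMatrix hm E := by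
  have h1 : ∀ a b, Continuous fun w : Piece δ m =>
      solution hm (w.intervalIntegrable_ext 0 m) E a b := fun a b =>
    continuous_iff_continuousAt.2 fun w₀ =>
      tendsto_solution hm (fun w : Piece δ m => w.intervalIntegrable_ext 0 m) _
        (tendsto_integral_ext hm w₀) E a b
  have h2 : ∀ a b, Continuous fun w : Piece δ m =>
      solutionDeriv hm (w.intervalIntegrable_ext 0 m) E a b := fun a b =>
    continuous_iff_continuousAt.2 fun w₀ =>
      tendsto_solutionDeriv hm (fun w : Piece δ m => w.intervalIntegrable_ext 0 m) _
        (tendsto_integral_ext hm w₀) E a b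
  refine continuous_matrix fun i j => ?_
  fin_cases i <;> fin_cases j
  exacts [continuous_IccExtend_len hm (h1 1 0), continuous_IccExtend_len hm (h1 0 1),
    continuous_IccExtend_len hm (h2 1 0), continuous_IccExtend_len hm (h2 0 1)]

theorem continuous_transferMatrix (hδ : 0 < δ) (hm : 0 ≤ m) (E : ℝ) :
    Continuous (transferMatrix E : Piece δ m → SL(2, ℝ)) := by
  refine continuous_induced_rng.2 (continuous_matrix fun i j => ?_)
  have h : ∀ w : Piece δ m, (transferMatrix E w : Matrix (Fin 2) (Fin 2) ℝ) i j =
      (w.fundamentalMatrix hm E i j).re := fun w => by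
    rw [← ofReal_transferMatrix hδ hm E w]; simp
  exact (Complex.continuous_re.comp ((continuous_fundamentalMatrix hm E).matrix_elem i j)).congr
    fun w => (h w).symm

/-- A continuous map sends the support into the support of the pushforward: preimages of
neighbourhoods of the image are neighbourhoods of f and have positive mass. -/
theorem transferMatrix_mem_transferGroup (hδ : 0 < δ) (hm : 0 ≤ m) {μ : Measure (Piece δ m)}
    {f : Piece δ m} (hf : f ∈ μ.support) (E : ℝ) : transferMatrix E f ∈ transferGroup μ E := by
  have hc := continuous_transferMatrix hδ hm (δ := δ) E
  refine Subgroup.le_topologicalClosure _ (Subgroup.subset_closure ?_)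
  rw [Measure.mem_support_iff_forall] at hf ⊢
  intro U hU
  exact (hf _ (hc.continuousAt hU)).trans_le (Measure.le_map_apply hc.measurable.aemeasurable U)

theorem differentiable_fundamentalMatrix (hm : 0 ≤ m) (w : Piece δ m) (i j : Fin 2) :
    Differentiable ℂ fun E => w.fundamentalMatrix hm E i j := by
  have h1 := fun a b => differentiable_IccExtend hm
    (differentiable_solution hm (w.intervalIntegrable_ext 0 m) a b) w.len
  have h2 := fun a b => differentiable_IccExtend hm
    (differentiable_solutionDeriv hm (w.intervalIntegrable_ext 0 m) a b) w.len
  fin_cases i <;> fin_cases j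
  exacts [h1 1 0, h1 0 1, h2 1 0, h2 0 1]

/-- Concatenation of potentials corresponds to multiplication of fundamental matrices. -/
theorem fundamentalMatrix_mul_mulVec (hδ : 0 < δ) (hm : 0 ≤ m) (w₁ w₂ : Piece δ m) {E : ℂ}
    {u u' : ℝ → ℂ} (hu : IsSchrodinger (w₁.len + w₂.len)
      (fun t => (concat w₁.len w₁.pot w₂.pot t : ℂ)) E u u') :
    (w₂.fundamentalMatrix hm E * w₁.fundamentalMatrix hm E).mulVec ![u 0, u' 0] =
      ![u (w₁.len + w₂.len), u' (w₁.len + w₂.len)] := by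
  have h1 := w₁.len_pos hδ
  have h2 := w₂.len_pos hδ
  have hne : ∀ᵐ x : ℝ, x ≠ w₁.len := by simp [ae_iff, measure_singleton]
  have hu₁ : IsSchrodinger w₁.len (fun t => (w₁.pot t : ℂ)) E u u' := by
    refine (hu.mono_mem ⟨h1.le, by linarith⟩).congr_potential h1.le ?_
    filter_upwards [hne] with x hx hxw
    rw [concat, if_pos (lt_of_le_of_ne hxw.2 hx)]
  have hu₂ : IsSchrodinger w₂.len (fun t => (w₂.pot t : ℂ)) E (fun x => u (x + w₁.len))
      (fun x => u' (x + w₁.len)) := by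
    have h := hu.shift h1.le (by linarith)
    rw [add_sub_cancel_left] at h
    refine h.congr_potential h2.le (Eventually.of_forall fun x hx => ?_)
    rw [concat, if_neg (by linarith [hx.1]), add_sub_cancel_right]
  have h3 := w₁.fundamentalMatrix_mulVec hδ hm hu₁
  have h4 := w₂.fundamentalMatrix_mulVec hδ hm hu₂
  rw [zero_add, ← h3] at h4
  rw [← Matrix.mulVec_mulVec, h4, add_comm w₁.len]

theorem intervalIntegrable_concat (hδ : 0 < δ) (w₁ w₂ : Piece δ m) :
    IntervalIntegrable (fun t => (concat w₁.len w₁.pot w₂.pot t : ℂ)) volume 0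
      (w₁.len + w₂.len) := by
  have h1 := w₁.len_pos hδ
  have h2 := w₂.len_pos hδ
  have hne : ∀ᵐ x : ℝ, x ≠ w₁.len := by simp [ae_iff, measure_singleton]
  have hi₁ := w₁.intervalIntegrable_pot h1.le
  have hi₂ := (w₂.intervalIntegrable_pot h2.le).comp_sub_right w₁.len
  rw [zero_add, add_comm w₂.len] at hi₂
  refine (hi₁.congr_ae ?_).trans (hi₂.congr_ae ?_)
  · rw [uIoc_of_le h1.le]
    refine (ae_restrict_iff' measurableSet_Ioc).2 ?_
    filter_upwards [hne] with x hx hxw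
    rw [concat, if_pos (lt_of_le_of_ne hxw.2 hx)]
  · rw [uIoc_of_le (by linarith)]
    refine (ae_restrict_iff' measurableSet_Ioc).2 (Eventually.of_forall fun x hx => ?_)
    change _ = ((concat w₁.len w₁.pot w₂.pot x : ℝ) : ℂ)
    rw [concat, if_neg (by linarith [hx.1])]

/-- If the fundamental matrices of two pieces commute at all complex energies, then the two
concatenations agree. -/
theorem concat_ae_eq_of_commute (hδ : 0 < δ) (hm : 0 ≤ m) (w₁ w₂ : Piece δ m)
    (h : ∀ E : ℂ, w₁.fundamentalMatrix hm E * w₂.fundamentalMatrix hm E =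
      w₂.fundamentalMatrix hm E * w₁.fundamentalMatrix hm E) :
    concat w₁.len w₁.pot w₂.pot =ᵐ[volume.restrict (Ico 0 (w₁.len + w₂.len))]
      concat w₂.len w₂.pot w₁.pot := by
  have hL : 0 < w₁.len + w₂.len := add_pos (w₁.len_pos hδ) (w₂.len_pos hδ)
  have hq₁ := intervalIntegrable_concat hδ w₁ w₂
  have hq₂ := intervalIntegrable_concat hδ w₂ w₁
  rw [add_comm w₂.len] at hq₂
  have key : ∀ E a b : ℂ,
      ![IccExtend hL.le (solution hL.le hq₁ E a b) (w₁.len + w₂.len),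
        IccExtend hL.le (solutionDeriv hL.le hq₁ E a b) (w₁.len + w₂.len)] =
      ![IccExtend hL.le (solution hL.le hq₂ E a b) (w₁.len + w₂.len),
        IccExtend hL.le (solutionDeriv hL.le hq₂ E a b) (w₁.len + w₂.len)] := by
    intro E a b
    rw [← fundamentalMatrix_mul_mulVec hδ hm w₁ w₂ (isSchrodinger_solution hL.le hq₁ E a b)]
    have h2 := isSchrodinger_solution hL.le hq₂ E a b
    have h3 := fundamentalMatrix_mul_mulVec hδ hm w₂ w₁ (E := E)
      (u := IccExtend hL.le (solution hL.le hq₂ E a b))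
      (u' := IccExtend hL.le (solutionDeriv hL.le hq₂ E a b)) (by rwa [add_comm w₂.len])
    rw [add_comm w₂.len] at h3
    rw [← h3, h E]
    simp only [solution_zero, solutionDeriv_zero]
  have hae := ae_eq_of_forall_solution_eq hL hq₁ hq₂ (fun E => congrFun (key E 1 0) 0)
    (fun E => congrFun (key E 1 0) 1) (fun E => congrFun (key E 0 1) 0)
    (fun E => congrFun (key E 0 1) 1)
  refine (ae_restrict_iff' measurableSet_Ico).2 ?_
  filter_upwards [hae] with x hx hxL
  exact Complex.ofReal_injective (hx (Ico_subset_Icc_self hxL))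

end TransferMatrixProperties

/-! ### The exceptional energies -/

section Exceptional

theorem eventually_ne_zero_of_differentiable {f : ℂ → ℂ} (hf : Differentiable ℂ f)
    (h : ∃ z, f z ≠ 0) (z₀ : ℂ) : ∀ᶠ z in 𝓝[≠] z₀, f z ≠ 0 := by
  by_contra hcon
  obtain ⟨z, hz⟩ := h
  refine hz ?_
  have hfreq : ∃ᶠ z in 𝓝[≠] z₀, f z = 0 := by
    exact (not_eventually.1 hcon).mono fun z hz => not_not.1 hz
  exact AnalyticOnNhd.eqOn_zero_of_preconnected_of_frequently_eq_zero
    (fun z _ => hf.analyticAt z) isPreconnected_univ (mem_univ z₀) hfreq (mem_univ z)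

theorem tendsto_ofReal_nhdsNE (x : ℝ) :
    Tendsto (fun y : ℝ => (y : ℂ)) (𝓝[≠] x) (𝓝[≠] (x : ℂ)) :=
  tendsto_nhdsWithin_of_tendsto_nhds_of_eventually_within _
    (Complex.continuous_ofReal.continuousAt.mono_left nhdsWithin_le_nhds)
    (eventually_mem_nhdsWithin.mono fun y hy => by simpa using hy)

/-- The real zeros of a function that has isolated zeros form a closed discrete set. -/
theorem isClosed_isDiscrete_zeros {f : ℂ → ℂ} (hf : Continuous f)
    (h : ∀ z₀, ∀ᶠ z in 𝓝[≠] z₀, f z ≠ 0) :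
    IsClosed {E : ℝ | f E = 0} ∧ IsDiscrete {E : ℝ | f E = 0} := by
  refine ⟨isClosed_eq (hf.comp Complex.continuous_ofReal) continuous_const,
    isDiscrete_iff_nhdsNE.2 fun x _ => ?_⟩
  rw [← disjoint_iff, disjoint_principal_right]
  exact (tendsto_ofReal_nhdsNE x).eventually (h x)

variable {δ m : ℝ}

theorem differentiable_trace (hm : 0 ≤ m) (w : Piece δ m) :
    Differentiable ℂ fun E => (w.fundamentalMatrix hm E).trace := by
  simp only [Matrix.trace_fin_two]
  exact (differentiable_fundamentalMatrix hm w 0 0).add (differentiable_fundamentalMatrix hm w 1 1)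

theorem differentiable_commutator (hm : 0 ≤ m) (w₁ w₂ : Piece δ m) (i j : Fin 2) :
    Differentiable ℂ fun E => (w₁.fundamentalMatrix hm E * w₂.fundamentalMatrix hm E -
      w₂.fundamentalMatrix hm E * w₁.fundamentalMatrix hm E) i j := by
  have h := fun (w : Piece δ m) i j => differentiable_fundamentalMatrix hm w i j
  simp only [Matrix.sub_apply, Matrix.mul_apply, Fin.sum_univ_two]
  exact (((h w₁ i 0).mul (h w₂ 0 j)).add ((h w₁ i 1).mul (h w₂ 1 j))).sub
    (((h w₂ i 0).mul (h w₁ 0 j)).add ((h w₂ i 1).mul (h w₁ 1 j)))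

/-- At some real energies the trace of the fundamental matrix is close to `2 cos θ`. -/
theorem exists_norm_trace_sub_lt (hδ : 0 < δ) (hm : 0 ≤ m) (w : Piece δ m) (θ : ℝ) :
    ∃ E : ℝ, ‖(w.fundamentalMatrix hm E).trace - 2 * Real.cos θ‖ < 1 := by
  have ha := w.len_pos hδ
  set Q := ∫ t in (0 : ℝ)..w.len, ‖(w.pot t : ℂ)‖ with hQ
  -- These k satisfy kL = θ + 2πn, so the cosine is exactly cos θ, and large n brings the error 4Q/k
  -- below 1.
  have hk : Tendsto (fun n : ℕ => (θ + n * (2 * Real.pi)) / w.len) atTop atTop :=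
    (tendsto_atTop_add_const_left _ _
      (tendsto_natCast_atTop_atTop.atTop_mul_const Real.two_pi_pos)).atTop_div_const ha
  obtain ⟨n, h1, h2, h3⟩ := ((hk.eventually_gt_atTop 0).and
    ((hk.eventually_ge_atTop (2 * Q)).and (hk.eventually_gt_atTop (4 * Q)))).exists
  set k := (θ + n * (2 * Real.pi)) / w.len with hkdef
  refine ⟨k ^ 2, ?_⟩
  have h4 := (w.isFundamental hδ hm ((k ^ 2 : ℝ) : ℂ)).norm_trace_sub_le ha.le
    (w.intervalIntegrable_pot ha.le) h1 h2
  have h5 : Complex.cos (k * w.len) = Real.cos θ := by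
    rw [← Complex.ofReal_mul, ← Complex.ofReal_cos, hkdef, div_mul_cancel₀ _ ha.ne',
      Real.cos_add_nat_mul_two_pi]
  rw [h5] at h4
  rw [Matrix.trace_fin_two]
  refine lt_of_le_of_lt h4 ?_
  rwa [div_lt_one h1]

theorem exists_trace_ne_zero (hδ : 0 < δ) (hm : 0 ≤ m) (w : Piece δ m) :
    ∃ E : ℂ, (w.fundamentalMatrix hm E).trace ≠ 0 := by
  obtain ⟨E, hE⟩ := exists_norm_trace_sub_lt hδ hm w 0
  refine ⟨E, fun h => ?_⟩
  rw [h] at hE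
  norm_num at hE

/-- Supplies a real elliptic energy, needed both for (tr)² ≢ 4 and for the commutator. -/
theorem exists_norm_trace_lt_one (hδ : 0 < δ) (hm : 0 ≤ m) (w : Piece δ m) :
    ∃ E : ℝ, ‖(w.fundamentalMatrix hm E).trace‖ < 1 := by
  obtain ⟨E, hE⟩ := exists_norm_trace_sub_lt hδ hm w (Real.pi / 2)
  exact ⟨E, by simpa using hE⟩

theorem exists_trace_sq_ne_four (hδ : 0 < δ) (hm : 0 ≤ m) (w : Piece δ m) :
    ∃ E : ℂ, (w.fundamentalMatrix hm E).trace ^ 2 - 4 ≠ 0 := by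
  obtain ⟨E, hE⟩ := exists_norm_trace_lt_one hδ hm w
  refine ⟨E, fun h => ?_⟩
  have h1 := congrArg norm (sub_eq_zero.1 h)
  rw [norm_pow] at h1
  norm_num at h1
  nlinarith [norm_nonneg (w.fundamentalMatrix hm E).trace]

theorem ofReal_trace_transferMatrix (hδ : 0 < δ) (hm : 0 ≤ m) (E : ℝ) (w : Piece δ m) :
    (((transferMatrix E w : Matrix (Fin 2) (Fin 2) ℝ).trace : ℝ) : ℂ) =
      (w.fundamentalMatrix hm E).trace := by
  rw [← ofReal_transferMatrix hδ hm E w, Matrix.trace_fin_two, Matrix.trace_fin_two]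
  simp

theorem map_commutator_transferMatrix (hδ : 0 < δ) (hm : 0 ≤ m) (E : ℝ) (w₁ w₂ : Piece δ m) :
    ((transferMatrix E w₁ : Matrix (Fin 2) (Fin 2) ℝ) * transferMatrix E w₂ -
      transferMatrix E w₂ * transferMatrix E w₁).map Complex.ofRealHom =
    w₁.fundamentalMatrix hm E * w₂.fundamentalMatrix hm E -
      w₂.fundamentalMatrix hm E * w₁.fundamentalMatrix hm E := by
  rw [← ofReal_transferMatrix hδ hm E w₁, ← ofReal_transferMatrix hδ hm E w₂]
  simp only [← RingHom.mapMatrix_apply, map_sub, map_mul]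

/-- If the commutator of two transfer matrices is singular at all energies, then the transfer
matrices commute at all energies. -/
theorem commute_of_forall_det_eq_zero (hδ : 0 < δ) (hm : 0 ≤ m) (w₁ w₂ : Piece δ m)
    (h : ∀ E : ℂ, (w₁.fundamentalMatrix hm E * w₂.fundamentalMatrix hm E -
      w₂.fundamentalMatrix hm E * w₁.fundamentalMatrix hm E).det = 0) (E : ℂ) :
    w₁.fundamentalMatrix hm E * w₂.fundamentalMatrix hm E =
      w₂.fundamentalMatrix hm E * w₁.fundamentalMatrix hm E := by
  obtain ⟨E₀, hE₀⟩ := exists_norm_trace_lt_one hδ hm w₁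
  have hev : ∀ᶠ E : ℝ in 𝓝[≠] E₀, w₁.fundamentalMatrix hm E * w₂.fundamentalMatrix hm E -
      w₂.fundamentalMatrix hm E * w₁.fundamentalMatrix hm E = 0 := by
    -- Ellipticity is an open condition, so the commutator vanishes on a real neighbourhood, enough
    -- for the identity theorem.
    have hlt : ∀ᶠ E : ℝ in 𝓝 E₀, ‖(w₁.fundamentalMatrix hm E).trace‖ < 1 :=
      ((differentiable_trace hm w₁).continuous.norm.comp
        Complex.continuous_ofReal).continuousAt.eventually_lt continuousAt_const hE₀
    filter_upwards [nhdsWithin_le_nhds hlt] with E hE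
    rw [← ofReal_trace_transferMatrix hδ hm E w₁, Complex.norm_real, Real.norm_eq_abs] at hE
    have hell : (transferMatrix E w₁ : Matrix (Fin 2) (Fin 2) ℝ).trace ^ 2 < 4 := by
      rw [← sq_abs]
      nlinarith [abs_nonneg (transferMatrix E w₁ : Matrix (Fin 2) (Fin 2) ℝ).trace]
    have hdet := h E
    rw [← map_commutator_transferMatrix hδ hm E w₁ w₂, ← RingHom.mapMatrix_apply,
      ← RingHom.map_det] at hdet
    have h1 := (det_commutator_of_elliptic (B := transferMatrix E w₂)
      (transferMatrix E w₁).det_coe hell).2 (Complex.ofReal_injective (by simpa using hdet))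
    rw [← map_commutator_transferMatrix hδ hm E w₁ w₂, h1, sub_self]
    simp
  rw [← sub_eq_zero]
  ext i j
  have hd := differentiable_commutator hm w₁ w₂ i j
  refine AnalyticOnNhd.eqOn_zero_of_preconnected_of_frequently_eq_zero
    (fun z _ => hd.analyticAt z) isPreconnected_univ (mem_univ (E₀ : ℂ)) ?_ (mem_univ E)
  refine (tendsto_ofReal_nhdsNE E₀).frequently (Eventually.frequently ?_)
  filter_upwards [hev] with E hE
  rw [hE, Matrix.zero_apply]

end Exceptional

end ContinuumAnderson

/-! ### The main theorem -/

theorem theorem2p5 {δ m : ℝ} (hδ : 0 < δ) (hδm : δ ≤ m)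
    (μ : Measure (ContinuumAnderson.Piece δ m)) [IsProbabilityMeasure μ]
    (hNC : ContinuumAnderson.Nontriviality μ) :
    ∃ D : Set ℝ, IsClosed D ∧ IsDiscrete D ∧
      ∀ E : ℝ, E ∉ D → ContinuumAnderson.IsTypeF (ContinuumAnderson.transferGroup μ E) := by
  open ContinuumAnderson in
  obtain ⟨f₁, hf₁, f₂, hf₂, hne⟩ := hNC
  have hm : 0 ≤ m := hδ.le.trans hδm
  set t₁ : ℂ → ℂ := fun E => (f₁.fundamentalMatrix hm E).trace
  set t₂ : ℂ → ℂ := fun E => (f₂.fundamentalMatrix hm E).trace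
  set d : ℂ → ℂ := fun E => (f₁.fundamentalMatrix hm E * f₂.fundamentalMatrix hm E -
      f₂.fundamentalMatrix hm E * f₁.fundamentalMatrix hm E).det with hd
  have ht₁ : Differentiable ℂ t₁ := differentiable_trace hm f₁
  have ht₂ : Differentiable ℂ t₂ := differentiable_trace hm f₂
  have hdd : Differentiable ℂ d := by
    have h := differentiable_commutator hm f₁ f₂
    simp only [hd, Matrix.det_fin_two]
    exact ((h 0 0).mul (h 1 1)).sub ((h 0 1).mul (h 1 0))
  have ht₁4 : Differentiable ℂ fun E => t₁ E ^ 2 - 4 := (ht₁.pow 2).sub_const 4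
  have hd0 : ∃ E, d E ≠ 0 := by
    by_contra hcon
    push Not at hcon
    exact hne (concat_ae_eq_of_commute hδ hm f₁ f₂
      (commute_of_forall_det_eq_zero hδ hm f₁ f₂ hcon))
  -- The factors are the four nondegeneracy conditions of `isTypeF_of_mem`; D is the real zero set
  -- of their product.
  have hF : ∀ z₀, ∀ᶠ z in 𝓝[≠] z₀, t₁ z * t₂ z * (t₁ z ^ 2 - 4) * d z ≠ 0 := by
    intro z₀
    filter_upwards [eventually_ne_zero_of_differentiable ht₁ (exists_trace_ne_zero hδ hm f₁) z₀,
      eventually_ne_zero_of_differentiable ht₂ (exists_trace_ne_zero hδ hm f₂) z₀,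
      eventually_ne_zero_of_differentiable ht₁4 (exists_trace_sq_ne_four hδ hm f₁) z₀,
      eventually_ne_zero_of_differentiable hdd hd0 z₀] with z h1 h2 h3 h4
    exact mul_ne_zero (mul_ne_zero (mul_ne_zero h1 h2) h3) h4
  obtain ⟨hclosed, hdiscrete⟩ := isClosed_isDiscrete_zeros
    (((ht₁.mul ht₂).mul ht₁4).mul hdd).continuous hF
  refine ⟨_, hclosed, hdiscrete, fun E hE => ?_⟩
  have hE' : t₁ E * t₂ E * (t₁ E ^ 2 - 4) * d E ≠ 0 := hE
  simp only [mul_ne_zero_iff] at hE'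
  obtain ⟨⟨⟨h1, h2⟩, h3⟩, h4⟩ := hE'
  have e₁ := ofReal_trace_transferMatrix hδ hm E f₁
  have e₂ := ofReal_trace_transferMatrix hδ hm E f₂
  refine isTypeF_of_mem (transferMatrix_mem_transferGroup hδ hm hf₁ E)
    (transferMatrix_mem_transferGroup hδ hm hf₂ E) (fun h => h1 ?_) (fun h => h3 ?_)
    (fun h => h2 ?_) (fun h => h4 ?_)
  · simp only [t₁, ← e₁, h, Complex.ofReal_zero]
  · simp only [t₁, ← e₁, ← Complex.ofReal_pow, h]
    norm_num
  · simp only [t₂, ← e₂, h, Complex.ofReal_zero]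
  · simp only [hd]
    rw [← map_commutator_transferMatrix hδ hm E f₁ f₂, ← RingHom.mapMatrix_apply,
      ← RingHom.map_det, h, map_zero]
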